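/- Let $(M^n,g,J)$ be an almost Hermitian manifold: $g$ is a smooth Riemannian metric and $J$ a smooth endomorphism field of $TM$ with $J^2=-\mathrm{Id}$ and $g(JX,JY)=g(X,Y)$. In local coordinates write $J\partial_i=J_i^j\partial_j$, $\omega_{ij}=g(J\partial_i,\partial_j)=J_i^a g_{ja}$, let $\omega^{ij}$ be the inverse matrix of $\omega_{ij}$, and let $\psi=d\omega$, i.e. $\psi_{ijk}=\partial_i\omega_{jk}+\partial_j\omega_{ki}+\partial_k\omega_{ij}$, and $\vartheta_k=\tfrac12\omega^{ji}\psi_{ijk}$ (the Lee form). The Nijenhuis tensor is $$N_{jk}^i=2\big(J_j^p\partial_pJ_k^i-J_k^p\partial_pJ_j^i-J_p^i\partial_jJ_k^p+J_p^i\partial_kJ_j^p\big),\qquad N_{ijk}=N_{ij}^l g_{lk}.$$ Let $\nabla=\partial+\Upsilon$ be the Chern connection, i.e. the unique connection with $\nabla g=0$, $\nabla J=0$ and $\tau^{1,1}=0$, where $\tau_{ij}^k=\Upsilon_{ij}^k-\Upsilon_{ji}^k$ is the torsion and $(\tau^{1,1})_{ij}^k=\tfrac12(\tau_{ij}^k+J_i^aJ_j^b\tau_{ab}^k)$.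 For a connection with coefficients $C_{ij}^k$ the curvature is $R_{ijk}^l=\partial_iC_{jk}^l-\partial_jC_{ik}^l+C_{is}^lC_{jk}^s-C_{js}^lC_{ik}^s$. Let $\mathrm{Rc}_{jk}=\mathrm{Rm}_{ijk}^i$ be the Ricci tensor of $g$ ($\mathrm{Rm}$ being the curvature of the Levi-Civita connection), let $\Omega$ be the curvature of $\nabla$, $\Omega_{ijkl}=\Omega_{ijk}^m g_{ml}$, and let $\mathcal P_{ab}=\omega^{cd}\Omega_{abcd}$ be the Chern--Ricci curvature. For expressions $A,B$ of second order in $(g,J)$, write $[A]_2=[B]_2$ if $A$ and $B$ have the same part of second order in $(g,J)$; that is, $A-B$ contains no second derivatives of $(g,J)$: in every chart and at every point it is a function (depending only on $n$) of the values and first partial derivatives of the components $g_{ij}$, $J_i^j$ at that point. Then $$\Big[\mathrm{Rc}_{jk}-\tfrac12J_k^a\mathcal P_{ja}\Big]_2=\Big[\tfrac14\nabla^lN_{klj}-\tfrac12\nabla_j\vartheta_k+\tfrac12J_k^aJ_j^y\nabla_a\vartheta_y-\tfrac12\nabla^e\big(J_e^r\psi_{jkr}+J_k^a\psi_{jae}\big)\Big]_2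 ,$$ where indices of $\nabla$ are raised with $g$. -/

import Mathlib

open scoped Manifold ContDiff Bundle

noncomputable section

namespace AlmostHermitian

/-- The coordinate space `ℝⁿ`. -/
abbrev Coord (n : ℕ) : Type := EuclideanSpace ℝ (Fin n)

/-- Real functions of `n` coordinates (the components of tensors in a chart). -/
abbrev Field (n : ℕ) : Type := Coord n → ℝ

/-! ### Almost Hermitian manifolds and their components in a chart -/

/-- A smooth almost Hermitian structure `(g, J)` on a smooth `n`-manifold `M`: a smooth Riemannian
metric and a smooth endomorphism field `J` of `TM` with `J² = -1` and `g(JX, JY) = g(X, Y)`. -/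
structure Structure (n : ℕ) (M : Type*) [TopologicalSpace M] [ChartedSpace (Coord n) M]
    [IsManifold (𝓡 n) ∞ M] where
  g : Bundle.ContMDiffRiemannianMetric (𝓡 n) ∞ (Coord n)
    (fun x : M => TangentSpace (𝓡 n) x)
  J : ∀ x : M, TangentSpace (𝓡 n) x →L[ℝ] TangentSpace (𝓡 n) x
  contMDiff_J : ContMDiff (𝓡 n) ((𝓡 n).prod 𝓘(ℝ, Coord n →L[ℝ] Coord n)) ∞
    (fun x : M => Bundle.TotalSpace.mk' (Coord n →L[ℝ] Coord n)
      (E := fun x : M => TangentSpace (𝓡 n) x →L[ℝ] TangentSpace (𝓡 n) x) x (J x))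
  J_sq : ∀ (x : M) (v : TangentSpace (𝓡 n) x), J x (J x v) = -v
  compatible : ∀ (x : M) (v w : TangentSpace (𝓡 n) x), g.inner x (J x v) (J x w) = g.inner x v w

section Chart

variable {n : ℕ} {M : Type*} [TopologicalSpace M] [ChartedSpace (Coord n) M]

/-- The coordinate vector `∂ᵢ` of the chart `e`, at the point with coordinates `y`. -/
def coordVector (e : OpenPartialHomeomorph M (Coord n)) (y : Coord n) (i : Fin n) :
    TangentSpace (𝓡 n) (e.symm y) :=
  mfderiv (𝓡 n) (𝓡 n) e.symm y (EuclideanSpace.single i (1 : ℝ) : Coord n)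

variable [IsManifold (𝓡 n) ∞ M]

/-- `g_{ij} = g(∂ᵢ, ∂ⱼ)`. -/
def Structure.metricComp (S : Structure n M) (e : OpenPartialHomeomorph M (Coord n))
    (i j : Fin n) : Field n := fun y =>
  S.g.inner (e.symm y) (coordVector e y i) (coordVector e y j)

/-- `J_i^j`, where `J ∂ᵢ = ∑ⱼ J_i^j ∂ⱼ`. -/
def Structure.complexComp (S : Structure n M) (e : OpenPartialHomeomorph M (Coord n))
    (i j : Fin n) : Field n := fun y =>
  let v : Coord n := mfderiv (𝓡 n) (𝓡 n) e (e.symm y) (S.J (e.symm y) (coordVector e y i))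
  v j

end Chart

/-! ### Tensor calculus in coordinates

Below `g i j` stands for `g_{ij}` and `J i j` for `J_i^j`; a connection is given by its
coefficients `Υ i j k = Υ_{ij}^k`, with `∇_{∂ᵢ} ∂ⱼ = ∑ₖ Υ_{ij}^k ∂ₖ`. -/

section Coordinates

variable {n : ℕ}

/-- The partial derivative `∂ᵢ f`. -/
def pd (i : Fin n) (f : Field n) : Field n := fun y =>
  fderiv ℝ f y (EuclideanSpace.single i (1 : ℝ))

/-- The entries of the pointwise inverse of a matrix of functions. -/
def invComp (A : Fin n → Fin n → Field n) (i j : Fin n) : Field n := fun y =>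
  (Matrix.of fun a b => A a b y)⁻¹ i j

/-- `ω(X, Y) = g(JX, Y)`, that is `ω_{ij} = J_i^a g_{ja}`. -/
def kahlerForm (g J : Fin n → Fin n → Field n) (i j : Fin n) : Field n :=
  ∑ a, J i a * g j a

/-- `ψ = dω`. -/
def psi (g J : Fin n → Fin n → Field n) (i j k : Fin n) : Field n :=
  pd i (kahlerForm g J j k) + pd j (kahlerForm g J k i) + pd k (kahlerForm g J i j)

/-- The Lee form `ϑ_k = ½ ω^{ji} ψ_{ijk}`, with `ω^{ij}` the inverse matrix of `ω_{ij}`. -/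
def leeForm (g J : Fin n → Fin n → Field n) (k : Fin n) : Field n :=
  (1 / 2 : ℝ) • ∑ i, ∑ j, invComp (kahlerForm g J) j i * psi g J i j k

/-- The Nijenhuis tensor; `nijenhuis J j k i` is `N_{jk}^i`. -/
def nijenhuis (J : Fin n → Fin n → Field n) (j k i : Fin n) : Field n :=
  (2 : ℝ) • ∑ p, (J j p * pd p (J k i) - J k p * pd p (J j i)
    - J p i * pd j (J k p) + J p i * pd k (J j p))

/-- `N_{ijk} = N_{ij}^l g_{lk}`. -/
def nijenhuisLow (g J : Fin n → Fin n → Field n) (i j k : Fin n) : Field n :=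
  ∑ l, nijenhuis J i j l * g l k

/-- The Christoffel symbols `Γ_{ij}^k` of the Levi-Civita connection of `g`. -/
def christoffel (g : Fin n → Fin n → Field n) (i j k : Fin n) : Field n :=
  (1 / 2 : ℝ) • ∑ l, invComp g k l * (pd i (g j l) + pd j (g i l) - pd l (g i j))

/-- The curvature `R_{ijk}^l` of the connection with coefficients `C`:
`(∇_i ∇_j - ∇_j ∇_i) ∂ₖ = ∑ₗ R_{ijk}^l ∂ₗ`. -/
def curvature (C : Fin n → Fin n → Fin n → Field n) (i j k l : Fin n) : Field n :=
  pd i (C j k l) - pd j (C i k l) + ∑ s, (C i s l * C j k s - C j s l * C i k s)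

/-- The Ricci tensor `Rc_{jk} = Rm_{ijk}^i` of `g`. -/
def ricci (g : Fin n → Fin n → Field n) (j k : Fin n) : Field n :=
  ∑ i, curvature (christoffel g) i j k i

/-- `P_{ab} = ω^{cd} Ω_{abcd}` with `Ω_{abcd} = Ω_{abc}^m g_{md}`, where `Ω` is the curvature of
the connection with coefficients `Υ` (the Chern–Ricci curvature if that is the Chern connection). -/
def chernRicci (g J : Fin n → Fin n → Field n) (Υ : Fin n → Fin n → Fin n → Field n)
    (a b : Fin n) : Field n :=
  ∑ c, ∑ d, invComp (kahlerForm g J) c d * ∑ m, curvature Υ a b c m * g m d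

/-- `∇_a T_i`. -/
def nabla1 (Υ : Fin n → Fin n → Fin n → Field n) (T : Fin n → Field n)
    (a i : Fin n) : Field n :=
  pd a (T i) - ∑ s, Υ a i s * T s

/-- `∇_a T_{ij}`. -/
def nabla2 (Υ : Fin n → Fin n → Fin n → Field n) (T : Fin n → Fin n → Field n)
    (a i j : Fin n) : Field n :=
  pd a (T i j) - ∑ s, (Υ a i s * T s j + Υ a j s * T i s)

/-- `∇_a T_{ijk}`. -/
def nabla3 (Υ : Fin n → Fin n → Fin n → Field n) (T : Fin n → Fin n → Fin n → Field n)
    (a i j k : Fin n) : Field n :=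
  pd a (T i j k) - ∑ s, (Υ a i s * T s j k + Υ a j s * T i s k + Υ a k s * T i j s)

/-- `∇_a A_i^j` for an endomorphism field `A`. -/
def nablaEnd (Υ : Fin n → Fin n → Fin n → Field n) (A : Fin n → Fin n → Field n)
    (a i j : Fin n) : Field n :=
  pd a (A i j) - ∑ s, Υ a i s * A s j + ∑ s, Υ a s j * A i s

/-- The torsion `τ_{ij}^k`. -/
def torsion (Υ : Fin n → Fin n → Fin n → Field n) (i j k : Fin n) : Field n :=
  Υ i j k - Υ j i k

/-- `Υ` are the coefficients, on the coordinate domain `U`, of the Chern connection of `(g, J)`: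
the connection `∇ = ∂ + Υ` with `∇ g = 0`, `∇ J = 0` and `τ^{1,1} = 0`. -/
structure IsChernConnection (U : Set (Coord n)) (g J : Fin n → Fin n → Field n)
    (Υ : Fin n → Fin n → Fin n → Field n) : Prop where
  smooth : ∀ i j k, ContDiffOn ℝ ∞ (Υ i j k) U
  metric : ∀ y ∈ U, ∀ a i j, nabla2 Υ g a i j y = 0
  complex : ∀ y ∈ U, ∀ a i j, nablaEnd Υ J a i j y = 0
  torsion : ∀ y ∈ U, ∀ i j k,
    (1 / 2 : ℝ) * (torsion Υ i j k y + ∑ a, ∑ b, J i a y * J j b y * torsion Υ a b k y) = 0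

/-- `Rc_{jk} - ½ J_k^a P_{ja}`. -/
def ricciDifference (g J : Fin n → Fin n → Field n) (Υ : Fin n → Fin n → Fin n → Field n)
    (j k : Fin n) : Field n :=
  ricci g j k - (1 / 2 : ℝ) • ∑ a, J k a * chernRicci g J Υ j a

/-- `∇^l N_{klj}`. -/
def divNijenhuis (g J : Fin n → Fin n → Field n) (Υ : Fin n → Fin n → Fin n → Field n)
    (j k : Fin n) : Field n :=
  ∑ l, ∑ m, invComp g l m * nabla3 Υ (nijenhuisLow g J) m k l j

/-- The tensor `J_e^r ψ_{jkr} + J_k^a ψ_{jae}` (in the index order `j, k, e`). -/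
def psiTwist (g J : Fin n → Fin n → Field n) (j k e : Fin n) : Field n :=
  ∑ r, J e r * psi g J j k r + ∑ a, J k a * psi g J j a e

/-- `∇^e (J_e^r ψ_{jkr} + J_k^a ψ_{jae})`. -/
def divPsiTwist (g J : Fin n → Fin n → Field n) (Υ : Fin n → Fin n → Fin n → Field n)
    (j k : Fin n) : Field n :=
  ∑ e, ∑ f, invComp g e f * nabla3 Υ (psiTwist g J) f j k e

/-- `¼ ∇^l N_{klj} - ½ ∇_j ϑ_k + ½ J_k^a J_j^y ∇_a ϑ_y - ½ ∇^e (J_e^r ψ_{jkr} + J_k^a ψ_{jae})`. -/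
def principalExpression (g J : Fin n → Fin n → Field n) (Υ : Fin n → Fin n → Fin n → Field n)
    (j k : Fin n) : Field n :=
  (1 / 4 : ℝ) • divNijenhuis g J Υ j k
    - (1 / 2 : ℝ) • nabla1 Υ (leeForm g J) j k
    + (1 / 2 : ℝ) • ∑ a, ∑ y, J k a * J j y * nabla1 Υ (leeForm g J) a y
    - (1 / 2 : ℝ) • divPsiTwist g J Υ j k

end Coordinates

/-! ### Lower order terms -/

/-- Possible values, at a point, of the components of `(g, J)` and of their first partial
derivatives. -/
structure OneJet (n : ℕ) where
  g : Fin n → Fin n → ℝ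
  J : Fin n → Fin n → ℝ
  dg : Fin n → Fin n → Fin n → ℝ
  dJ : Fin n → Fin n → Fin n → ℝ

/-- The `1`-jet of the components `(g, J)` at the point with coordinates `y`. -/
def oneJet {n : ℕ} (g J : Fin n → Fin n → Field n) (y : Coord n) : OneJet n where
  g i j := g i j y
  J i j := J i j y
  dg a i j := pd a (g i j) y
  dJ a i j := pd a (J i j) y

end AlmostHermitian

end

/-!
The statement says that `Rc - ½ P(·, J·)` minus the right hand side, a function of the `2`-jet of
`(g, J)` at a point, depends on the `1`-jet only. So let two almost Hermitian structures in
coordinates have the same `1`-jet at a point (`PointedChart`), and subtract.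

The Chern connection `Υ` at a point is determined by the `1`-jet (`Υ_eq_of_jet_eq`), since the
difference of two candidates is skew, commutes with `J` and has no `(1,1)` torsion
(`connectionDifference_eq_zero`). Hence all quantities of first order agree for the two structures,
and in the difference of two expressions of second order every product of such quantities drops
out: the difference is linear in the differences of the derivatives (`AgreeAt` is the calculus for
this). As `∇g = 0` and `∇J = 0` express `∂g` and `∂J` by `Υ`, everything is linear in the
difference `V a b i j` of the two values of `∂_a Υ_{bi}^s g_{sj}` (`variation`, `form`).

The form `V` has three symmetries (`IsChernVariation`): the derivatives `∂_a ∂_b` of `g` and of `J`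
commute, so that `R(a,b,i,j) = V(a,b,i,j) - V(b,a,i,j)` is skew and `J`-invariant in `i, j`; and
`T(a;i,j,k) = V(a,i,j,k) - V(a,j,i,k)` changes sign when `J` is applied to both `i` and `j`. In
these terms `∂_a ψ_{ijk}` is minus the cyclic sum of `T(a;i,j,Jk)`, `∂_a ϑ_k` is the trace of
`T(a;k,x,x)`, and `∂_a N_{jkl} = 4 (T(a;j,k,l) - T(a;Jj,k,Jl))`. The difference of the two sides of
the theorem becomes a trace of terms in `R` and `T`. The first Bianchi identity, an identity of
definitions for `R` and `T`, is used for three choices of its arguments, contracted with the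
inverse metric (`trace_bianchi₁`, `trace_bianchi₂`, `trace_bianchi₃`); because the trace is
`J`-invariant, these eliminate all curvature terms, and the torsion terms then cancel too
(`secondOrder_identity`).
-/

namespace AlmostHermitian

open Filter Topology

variable {n : ℕ}

/-! ### Calculus of partial derivatives -/

theorem pd_congr {F G : Field n} {y : Coord n} (h : F =ᶠ[𝓝 y] G) (a : Fin n) :
    pd a F y = pd a G y := by
  simp only [pd, h.fderiv_eq]

theorem pd_const (c : ℝ) (a : Fin n) (y : Coord n) : pd a (fun _ => c) y = 0 := by
  simp [pd]

theorem pd_add {F G : Field n} {y : Coord n} (hF : DifferentiableAt ℝ F y)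
    (hG : DifferentiableAt ℝ G y) (a : Fin n) : pd a (F + G) y = pd a F y + pd a G y := by
  simp [pd, fderiv_add hF hG]

theorem pd_sub {F G : Field n} {y : Coord n} (hF : DifferentiableAt ℝ F y)
    (hG : DifferentiableAt ℝ G y) (a : Fin n) : pd a (F - G) y = pd a F y - pd a G y := by
  simp [pd, fderiv_sub hF hG]

theorem pd_smul {F : Field n} {y : Coord n} (hF : DifferentiableAt ℝ F y) (c : ℝ) (a : Fin n) :
    pd a (c • F) y = c * pd a F y := by
  simp [pd, fderiv_const_smul hF]

theorem pd_mul {F G : Field n} {y : Coord n} (hF : DifferentiableAt ℝ F y)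
    (hG : DifferentiableAt ℝ G y) (a : Fin n) :
    pd a (F * G) y = pd a F y * G y + F y * pd a G y := by
  simp [pd, fderiv_mul hF hG]
  ring

theorem pd_sum {ι : Type*} (s : Finset ι) {F : ι → Field n} {y : Coord n}
    (hF : ∀ i ∈ s, DifferentiableAt ℝ (F i) y) (a : Fin n) :
    pd a (∑ i ∈ s, F i) y = ∑ i ∈ s, pd a (F i) y := by
  simp [pd, fderiv_sum hF]

theorem pd_comm {F : Field n} {y : Coord n} (hF : ContDiffAt ℝ ∞ F y) (a b : Fin n) :
    pd a (pd b F) y = pd b (pd a F) y := by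
  have hd : DifferentiableAt ℝ (fderiv ℝ F) y :=
    (hF.fderiv_right (m := ∞) (by simp)).differentiableAt (by simp)
  have key : ∀ a b : Fin n, pd a (pd b F) y
      = fderiv ℝ (fderiv ℝ F) y (EuclideanSpace.single a 1) (EuclideanSpace.single b 1) := by
    intro a b
    change fderiv ℝ (fun z => fderiv ℝ F z (EuclideanSpace.single b (1 : ℝ))) y _ = _
    rw [fderiv_clm_apply hd (differentiableAt_const _)]
    simp
  have hs : IsSymmSndFDerivAt ℝ F y := hF.isSymmSndFDerivAt
    (by simpa using (WithTop.coe_le_coe.2 le_top : ((2 : ℕ∞) : WithTop ℕ∞) ≤ ∞))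
  rw [key, key, hs.eq]

theorem differentiableAt_det {m : Type*} [Fintype m] [DecidableEq m] {A : m → m → Field n}
    {y : Coord n} (hA : ∀ i j, DifferentiableAt ℝ (A i j) y) :
    DifferentiableAt ℝ (fun z => (Matrix.of fun i j => A i j z).det) y := by
  simp only [Matrix.det_apply, Matrix.of_apply]
  refine DifferentiableAt.fun_sum fun σ _ => DifferentiableAt.const_smul ?_ _
  exact (HasFDerivAt.finsetProd fun i _ => (hA (σ i) i).hasFDerivAt).differentiableAt

theorem differentiableAt_invComp {A : Fin n → Fin n → Field n} {y : Coord n}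
    (hA : ∀ i j, DifferentiableAt ℝ (A i j) y)
    (hdet : (Matrix.of fun i j => A i j y).det ≠ 0) (i j : Fin n) :
    DifferentiableAt ℝ (invComp A i j) y := by
  have hadj : DifferentiableAt ℝ
      (fun z => (Matrix.of fun i j => A i j z).adjugate i j) y := by
    simp only [Matrix.adjugate_apply]
    have := differentiableAt_det (y := y)
      (A := fun k l z => (Matrix.of fun i j => A i j z).updateRow j (Pi.single i 1) k l) (by
        intro k l
        by_cases hk : k = j
        · subst hk; simp
        · simpa [Matrix.updateRow_ne hk] using hA k l)
    exact this
  have := ((differentiableAt_det hA).inv hdet).mul hadj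
  refine this.congr_of_eventuallyEq (Eventually.of_forall fun z => ?_)
  simp [invComp, Matrix.inv_def]

/-! ### Comparison of two fields to first order -/

/-- The functions `F` near `y` and `F'` near `y'` are differentiable and have the same value, and
their partial derivatives differ by `d`. When `F` and `F'` are the same first order expression in
two structures with equal `1`-jets, `d` is the difference of the parts of second order. -/
structure AgreeAt (y y' : Coord n) (F F' : Field n) (d : Fin n → ℝ) : Prop where
  left : DifferentiableAt ℝ F y
  right : DifferentiableAt ℝ F' y'
  val : F y = F' y'
  der : ∀ a, pd a F y - pd a F' y' = d a

namespace AgreeAt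

variable {y y' : Coord n} {F F' G G' : Field n} {d d₁ d₂ : Fin n → ℝ}

theorem congr_der (h : AgreeAt y y' F F' d₁) (hd : ∀ a, d₁ a = d₂ a) : AgreeAt y y' F F' d₂ :=
  ⟨h.left, h.right, h.val, fun a => (h.der a).trans (hd a)⟩

theorem congr (h : AgreeAt y y' F F' d) (hG : G =ᶠ[𝓝 y] F) (hG' : G' =ᶠ[𝓝 y'] F') :
    AgreeAt y y' G G' d :=
  ⟨h.left.congr_of_eventuallyEq hG, h.right.congr_of_eventuallyEq hG',
    by rw [hG.eq_of_nhds, hG'.eq_of_nhds, h.val],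
    fun a => by rw [pd_congr hG, pd_congr hG', h.der]⟩

theorem der_unique (h₁ : AgreeAt y y' F F' d₁) (h₂ : AgreeAt y y' F F' d₂) (a : Fin n) :
    d₁ a = d₂ a := (h₁.der a).symm.trans (h₂.der a)

theorem const (c : ℝ) : AgreeAt y y' (fun _ => c) (fun _ => c) (fun _ => 0) :=
  ⟨by fun_prop, by fun_prop, rfl, fun a => by simp [pd_const]⟩

theorem add (hF : AgreeAt y y' F F' d₁) (hG : AgreeAt y y' G G' d₂) :
    AgreeAt y y' (F + G) (F' + G') (fun a => d₁ a + d₂ a) :=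
  ⟨hF.left.add hG.left, hF.right.add hG.right, by simp [hF.val, hG.val], fun a => by
    rw [pd_add hF.left hG.left, pd_add hF.right hG.right, ← hF.der, ← hG.der]; ring⟩

theorem sub (hF : AgreeAt y y' F F' d₁) (hG : AgreeAt y y' G G' d₂) :
    AgreeAt y y' (F - G) (F' - G') (fun a => d₁ a - d₂ a) :=
  ⟨hF.left.sub hG.left, hF.right.sub hG.right, by simp [hF.val, hG.val], fun a => by
    rw [pd_sub hF.left hG.left, pd_sub hF.right hG.right, ← hF.der, ← hG.der]; ring⟩

theorem smul (c : ℝ) (hF : AgreeAt y y' F F' d) :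
    AgreeAt y y' (c • F) (c • F') (fun a => c * d a) :=
  ⟨hF.left.const_smul c, hF.right.const_smul c, by simp [hF.val], fun a => by
    rw [pd_smul hF.left, pd_smul hF.right, ← hF.der]; ring⟩

theorem mul (hF : AgreeAt y y' F F' d₁) (hG : AgreeAt y y' G G' d₂) :
    AgreeAt y y' (F * G) (F' * G') (fun a => d₁ a * G y + F y * d₂ a) :=
  ⟨hF.left.mul hG.left, hF.right.mul hG.right, by simp [hF.val, hG.val], fun a => by
    rw [pd_mul hF.left hG.left, pd_mul hF.right hG.right, ← hF.der, ← hG.der, hF.val, hG.val]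
    ring⟩

theorem sum {ι : Type*} (s : Finset ι) {F F' : ι → Field n} {d : ι → Fin n → ℝ}
    (h : ∀ i ∈ s, AgreeAt y y' (F i) (F' i) (d i)) :
    AgreeAt y y' (∑ i ∈ s, F i) (∑ i ∈ s, F' i) (fun a => ∑ i ∈ s, d i a) :=
  ⟨DifferentiableAt.sum fun i hi => (h i hi).left,
    DifferentiableAt.sum fun i hi => (h i hi).right,
    by simp only [Finset.sum_apply]; exact Finset.sum_congr rfl fun i hi => (h i hi).val,
    fun a => by
      rw [pd_sum s fun i hi => (h i hi).left, pd_sum s fun i hi => (h i hi).right,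
        ← Finset.sum_sub_distrib]
      exact Finset.sum_congr rfl fun i hi => (h i hi).der a⟩

/-- A product whose left factor agrees to first order. -/
theorem mul_of_left (hF : AgreeAt y y' F F' (fun _ => 0)) (hG : AgreeAt y y' G G' d) :
    AgreeAt y y' (F * G) (F' * G') (fun a => F y * d a) :=
  (hF.mul hG).congr_der fun a => by ring

/-- A product whose right factor agrees to first order. -/
theorem mul_of_right (hF : AgreeAt y y' F F' d) (hG : AgreeAt y y' G G' (fun _ => 0)) :
    AgreeAt y y' (F * G) (F' * G') (fun a => d a * G y) :=
  (hF.mul hG).congr_der fun a => by ring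

/-- If two matrices of functions agree to first order, so do their inverses. -/
theorem invComp {A A' : Fin n → Fin n → Field n}
    (h : ∀ i j, AgreeAt y y' (A i j) (A' i j) (fun _ => 0))
    (hdet : ∀ᶠ z in 𝓝 y, (Matrix.of fun i j => A i j z).det ≠ 0)
    (hdet' : ∀ᶠ z in 𝓝 y', (Matrix.of fun i j => A' i j z).det ≠ 0) (i j : Fin n) :
    AgreeAt y y' (AlmostHermitian.invComp A i j) (AlmostHermitian.invComp A' i j)
      (fun _ => 0) := by
  have hB : ∀ i j, AgreeAt y y' (AlmostHermitian.invComp A i j) (AlmostHermitian.invComp A' i j)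
      (fun a => pd a (AlmostHermitian.invComp A i j) y
        - pd a (AlmostHermitian.invComp A' i j) y') := fun i j =>
    ⟨differentiableAt_invComp (fun i j => (h i j).left) hdet.self_of_nhds i j,
      differentiableAt_invComp (fun i j => (h i j).right) hdet'.self_of_nhds i j,
      by simp only [AlmostHermitian.invComp, (h _ _).val], fun a => rfl⟩
  refine (hB i j).congr_der fun a => ?_
  set D : Matrix (Fin n) (Fin n) ℝ := Matrix.of fun i j =>
    pd a (AlmostHermitian.invComp A i j) y - pd a (AlmostHermitian.invComp A' i j) y' with hD
  set A₀ : Matrix (Fin n) (Fin n) ℝ := Matrix.of fun i j => A i j y with hA₀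
  -- differentiate `A⁻¹ A = 1` in both structures
  have hone : ∀ (B : Fin n → Fin n → Field n) (z₀ : Coord n),
      (∀ᶠ z in 𝓝 z₀, (Matrix.of fun i j => B i j z).det ≠ 0) → ∀ i j,
      (fun _ => (1 : Matrix (Fin n) (Fin n) ℝ) i j)
        =ᶠ[𝓝 z₀] ∑ m, AlmostHermitian.invComp B i m * B m j := by
    intro B z₀ hB i j
    filter_upwards [hB] with z hz
    have := congrFun (congrFun (Matrix.nonsing_inv_mul (Matrix.of fun i j => B i j z)
      (isUnit_iff_ne_zero.2 hz)) i) j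
    rw [← this, Matrix.mul_apply]
    simp [AlmostHermitian.invComp]
  have hDA : D * A₀ = 0 := by
    ext i j
    have h1 := AgreeAt.sum Finset.univ (fun m _ => (hB i m).mul_of_right (h m j))
    have h2 := (h1.congr (hone A y hdet i j) (hone A' y' hdet' i j)).der_unique (const _) a
    simpa [Matrix.mul_apply, hD, hA₀] using h2
  have hD0 : D = 0 := by
    have hu : IsUnit A₀.det := isUnit_iff_ne_zero.2 hdet.self_of_nhds
    rw [← Matrix.mul_nonsing_inv_cancel_right A₀ D hu, hDA, Matrix.zero_mul]
  exact congrFun (congrFun hD0 i) j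

end AgreeAt

theorem curvature_sub_curvature {y y' : Coord n} {C C' : Fin n → Fin n → Fin n → Field n}
    {d : Fin n → Fin n → Fin n → Fin n → ℝ}
    (h : ∀ i j k, AgreeAt y y' (C i j k) (C' i j k) (fun a => d a i j k)) (i j k l : Fin n) :
    curvature C i j k l y - curvature C' i j k l y' = d i j k l - d j i k l := by
  simp only [curvature, Pi.add_apply, Pi.sub_apply, Finset.sum_apply, Pi.mul_apply, (h _ _ _).val]
  rw [← (h j k l).der i, ← (h i k l).der j]
  ring

theorem nabla1_sub_nabla1 {y y' : Coord n} {Υ Υ' : Fin n → Fin n → Fin n → Field n}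
    {T T' : Fin n → Field n} {d : Fin n → Fin n → ℝ}
    (hΥ : ∀ i j k, Υ i j k y = Υ' i j k y')
    (h : ∀ i, AgreeAt y y' (T i) (T' i) (fun a => d a i)) (a i : Fin n) :
    nabla1 Υ T a i y - nabla1 Υ' T' a i y' = d a i := by
  simp only [nabla1, Pi.sub_apply, Finset.sum_apply, Pi.mul_apply, (h _).val, hΥ]
  rw [← (h i).der a]
  ring

theorem nabla3_sub_nabla3 {y y' : Coord n} {Υ Υ' : Fin n → Fin n → Fin n → Field n}
    {T T' : Fin n → Fin n → Fin n → Field n} {d : Fin n → Fin n → Fin n → Fin n → ℝ}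
    (hΥ : ∀ i j k, Υ i j k y = Υ' i j k y')
    (h : ∀ i j k, AgreeAt y y' (T i j k) (T' i j k) (fun a => d a i j k)) (a i j k : Fin n) :
    nabla3 Υ T a i j k y - nabla3 Υ' T' a i j k y' = d a i j k := by
  simp only [nabla3, Pi.sub_apply, Pi.add_apply, Finset.sum_apply, Pi.mul_apply, (h _ _ _).val, hΥ]
  rw [← (h i j k).der a]
  ring

/-! ### Linear algebra of second order parts -/

section LinearAlgebra

variable {E : Type*} [AddCommGroup E] [Module ℝ E]

/-- The algebraic uniqueness of the Chern connection: the difference `A` of two of them (with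
the last index lowered) is skew, commutes with `J`, and has no `(1,1)` torsion, so it is `0`. -/
theorem connectionDifference_eq_zero {J : E →ₗ[ℝ] E} (hJ : ∀ x, J (J x) = -x)
    {A : E →ₗ[ℝ] E →ₗ[ℝ] E →ₗ[ℝ] ℝ} (hskew : ∀ x y z, A x y z + A x z y = 0)
    (hcomm : ∀ x y z, A x (J y) z + A x y (J z) = 0)
    (htor : ∀ x y z, A x y z - A y x z + (A (J x) (J y) z - A (J y) (J x) z) = 0)
    (x y z : E) : A x y z = 0 := by
  -- `Z x y z = A x y z + A (J x) (J y) z` is symmetric in `x, y`; moving `J` around makes it `0`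
  have hZ : ∀ x y z, A x y z + A (J x) (J y) z = 0 := by
    intro x y z
    have h1 := htor x y z
    have h2 := htor x (J y) (J z)
    have h3 := htor (J x) y (J z)
    have h4 := hcomm x y (J z)
    have h5 := hcomm y x (J z)
    have h6 := hcomm (J x) (J y) (J z)
    have h7 := hcomm (J y) (J x) (J z)
    simp only [hJ, map_neg, LinearMap.neg_apply] at h1 h2 h3 h4 h5 h6 h7
    linarith
  -- so `A (J x) y z = A x (J y) z`, the left side skew and the right side symmetric in `y, z`
  have h1 := hZ x (J y) (J z)
  have h2 := hZ x (J z) (J y)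
  have h3 := hskew x (J y) (J z)
  have h4 := hskew (J x) y (J z)
  have h5 := hskew (J x) z (J y)
  have h6 := hcomm (J x) y z
  have h7 := hcomm x y (J z)
  have h8 := hskew x y z
  simp only [hJ, map_neg, LinearMap.neg_apply] at h1 h2 h3 h4 h5 h6 h7 h8
  linarith

variable (J : E →ₗ[ℝ] E) (V : E →ₗ[ℝ] E →ₗ[ℝ] E →ₗ[ℝ] E →ₗ[ℝ] ℝ)

/-- The second order part of `∂_a ∂_b g_{ij}`, where `V a b i j` is that of
`∂_a Υ_{bi}^s g_{sj}`. -/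
def metricPart (a b i j : E) : ℝ := V a b i j + V a b j i

/-- The second order part of `∂_a ∂_b J_i^s g_{sj}`. -/
def complexPart (a b i j : E) : ℝ := -V a b i (J j) - V a b (J i) j

/-- The second order part of `∂_a ∂_b ω_{ij}`. -/
def kahlerPart (a b i j : E) : ℝ := V a b j (J i) - V a b i (J j)

/-- The second order part of `∂_a ψ_{ijk}`. -/
def psiPart (a i j k : E) : ℝ :=
  kahlerPart J V a i j k + kahlerPart J V a j k i + kahlerPart J V a k i j

/-- The second order part of `∂_a N_{jkl}`. -/
def nijenhuisPart (a j k l : E) : ℝ :=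
  2 * (complexPart J V a (J j) k l - complexPart J V a (J k) j l
    + complexPart J V a j k (J l) - complexPart J V a k j (J l))

/-- The second order part of the curvature `Ω_{abij}`. -/
def curvaturePart (a b i j : E) : ℝ := V a b i j - V b a i j

/-- The second order part of `∂_a τ_{ij}^s g_{sk}`. -/
def torsionPart (a i j k : E) : ℝ := V a i j k - V a j i k

/-- The symmetries of the difference `V` of the derivatives of two Chern connections whose
structures have the same `1`-jet: second derivatives of `g` and of `J` commute, and the torsion
has no `(1,1)` part. -/
structure IsChernVariation : Prop where
  sq : ∀ x, J (J x) = -x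
  metric : ∀ a b i j, metricPart V a b i j = metricPart V b a i j
  complex : ∀ a b i j, complexPart J V a b i j = complexPart J V b a i j
  torsion : ∀ a i j k, torsionPart V a i j k + torsionPart V a (J i) (J j) k = 0

variable {J V}

/-- `F` is linear in each of its two arguments. -/
structure IsBilin (F : E → E → ℝ) : Prop where
  left : ∀ y, IsLinearMap ℝ fun x => F x y
  right : ∀ x, IsLinearMap ℝ (F x)

variable (J) in
/-- A linear functional on functions of two vectors with the properties of the contraction with
the inverse of a metric for which `J` is an isometry. -/
structure IsHermitianTrace (tr : (E → E → ℝ) →ₗ[ℝ] ℝ) : Prop where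
  symm : ∀ F, tr (fun x y => F y x) = tr F
  invariant : ∀ F, IsBilin F → tr (fun x y => F (J x) (J y)) = tr F

/-- A trace vanishes on `B - B(J·, J·)` and on `C - Cᵀ`, which is how traces are compared below. -/
theorem IsHermitianTrace.eq_zero {tr : (E → E → ℝ) →ₗ[ℝ] ℝ} (h : IsHermitianTrace J tr)
    {D B C : E → E → ℝ} (hB : IsBilin B)
    (hD : ∀ x y, D x y = B x y - B (J x) (J y) + (C x y - C y x)) : tr D = 0 := by
  have : D = (B - fun x y => B (J x) (J y)) + (C - fun x y => C y x) :=
    funext₂ hD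
  rw [this, map_add, map_sub, map_sub, h.symm C, h.invariant B hB, sub_self, sub_self, add_zero]

theorem neg_left (V : E →ₗ[ℝ] E →ₗ[ℝ] E →ₗ[ℝ] E →ₗ[ℝ] ℝ) (a b i j : E) :
    V (-a) b i j = -V a b i j := by
  rw [← neg_one_smul ℝ a, map_smul]
  simp

namespace IsChernVariation

variable {tr : (E → E → ℝ) →ₗ[ℝ] ℝ}

theorem curvaturePart_skew (hV : IsChernVariation J V) (a b i j : E) :
    curvaturePart V a b i j + curvaturePart V a b j i = 0 := by
  have := hV.metric a b i j
  simp only [metricPart, curvaturePart] at *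
  linarith

theorem curvaturePart_map_map (hV : IsChernVariation J V) (a b i j : E) :
    curvaturePart V a b (J i) (J j) = curvaturePart V a b i j := by
  have := hV.complex a b i (J j)
  simp only [complexPart, curvaturePart, hV.sq, map_neg] at *
  linarith

/-- The trace of `ψ` that defines the Lee form, in terms of the torsion. -/
theorem trace_psiPart (hV : IsChernVariation J V) (htr : IsHermitianTrace J tr) (a k : E) :
    tr (fun x y => psiPart J V a (J y) x k + 2 * torsionPart V a k x y) = 0 := by
  refine htr.eq_zero (B := fun x y => torsionPart V a k y x)
    (C := fun x y => torsionPart V a k x y - 1 / 2 * torsionPart V a (J y) x (J k))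
    ⟨fun y => ⟨?_, ?_⟩, fun x => ⟨?_, ?_⟩⟩ fun x y => ?_
  · intros; simp [torsionPart]; ring
  · intros; simp [torsionPart]; ring
  · intros; simp [torsionPart]; ring
  · intros; simp [torsionPart]; ring
  have h1 := hV.torsion a (J y) x (J k)
  simp only [psiPart, kahlerPart, torsionPart, hV.sq, map_neg, LinearMap.neg_apply] at *
  linarith

/-- The first Bianchi identity for `x, j, Jy`, contracted over `x, y` with last argument `Jk`; the
terms with `J` on the other contracted index are brought to this form by the `J`-invariance of
the trace. -/
theorem trace_bianchi₁ (hV : IsChernVariation J V) (htr : IsHermitianTrace J tr) (j k : E) :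
    tr (fun x y => 2 * curvaturePart V x j k y + curvaturePart V x (J y) j (J k)
      - 2 * torsionPart V x (J y) j (J k)) = 0 := by
  refine htr.eq_zero
    (B := fun x y => curvaturePart V j (J y) x (J k) - torsionPart V (J y) x j (J k))
    (C := fun x y => -curvaturePart V j y (J x) (J k) - 1 / 2 * torsionPart V j (J y) x (J k)
      + torsionPart V y (J x) j (J k))
    ⟨fun y => ⟨?_, ?_⟩, fun x => ⟨?_, ?_⟩⟩ fun x y => ?_
  · intros; simp [torsionPart, curvaturePart]; ring
  · intros; simp [torsionPart, curvaturePart]; ring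
  · intros; simp [torsionPart, curvaturePart]; ring
  · intros; simp [torsionPart, curvaturePart]; ring
  have h1 := hV.torsion j (J y) x (J k)
  have h2 := hV.curvaturePart_map_map x j k y
  have h3 := hV.curvaturePart_skew x j (J k) (J y)
  simp only [curvaturePart, torsionPart, hV.sq, neg_left, map_neg, LinearMap.neg_apply] at *
  linarith

/-- The first Bianchi identity for `Jx, Jk, y`, contracted over `x, y` with last argument `j`. -/
theorem trace_bianchi₂ (hV : IsChernVariation J V) (htr : IsHermitianTrace J tr) (j k : E) :
    tr (fun x y => 2 * curvaturePart V (J x) (J k) y j + curvaturePart V y (J x) (J k) j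
      - 2 * torsionPart V x k y j) = 0 := by
  refine htr.eq_zero
    (B := fun x y => torsionPart V (J x) (J k) y j - curvaturePart V (J k) y (J x) j)
    (C := fun x y => 1 / 2 * torsionPart V (J k) y (J x) j + curvaturePart V (J x) (J k) y j
      - torsionPart V x k y j)
    ⟨fun y => ⟨?_, ?_⟩, fun x => ⟨?_, ?_⟩⟩ fun x y => ?_
  · intros; simp [torsionPart, curvaturePart]; ring
  · intros; simp [torsionPart, curvaturePart]; ring
  · intros; simp [torsionPart, curvaturePart]; ring
  · intros; simp [torsionPart, curvaturePart]; ring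
  have h1 := hV.torsion x k y j
  have h2 := hV.torsion (J k) y (J x) j
  have h3 := hV.torsion y x k j
  simp only [curvaturePart, torsionPart, hV.sq, neg_left, map_neg, LinearMap.neg_apply] at *
  linarith

/-- The first Bianchi identity for `j, Jk, x`, contracted over `x, y` with last argument `Jy`: it
expresses the Chern–Ricci curvature by the two other traces of the curvature. -/
theorem trace_bianchi₃ (hV : IsChernVariation J V) (htr : IsHermitianTrace J tr) (j k : E) :
    tr (fun x y => curvaturePart V j (J k) x (J y) + curvaturePart V x j k y
      - curvaturePart V (J x) (J k) y j - torsionPart V j k x y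
      - torsionPart V (J k) (J j) x y - torsionPart V x j (J k) (J y)) = 0 := by
  refine htr.eq_zero
    (B := fun x y => torsionPart V (J k) x j (J y) - torsionPart V j k x y
      - curvaturePart V (J k) x j (J y)) (C := fun _ _ => 0)
    ⟨fun y => ⟨?_, ?_⟩, fun x => ⟨?_, ?_⟩⟩ fun x y => ?_
  · intros; simp [torsionPart, curvaturePart]; ring
  · intros; simp [torsionPart, curvaturePart]; ring
  · intros; simp [torsionPart, curvaturePart]; ring
  · intros; simp [torsionPart, curvaturePart]; ring
  have h1 := hV.torsion j (J k) x (J y)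
  have h2 := hV.torsion (J k) (J x) j y
  have h3 := hV.curvaturePart_map_map x j k y
  have h4 := hV.curvaturePart_skew (J x) (J k) j y
  simp only [curvaturePart, torsionPart, hV.sq, map_neg, LinearMap.neg_apply] at *
  linarith

theorem trace_curvaturePart_map (hV : IsChernVariation J V) (htr : IsHermitianTrace J tr)
    (j k : E) :
    tr (fun x y => curvaturePart V x (J y) j (J k) + curvaturePart V y (J x) (J k) j) = 0 := by
  refine htr.eq_zero (B := fun _ _ => 0) (C := fun x y => curvaturePart V y (J x) (J k) j)
    ⟨fun y => ⟨?_, ?_⟩, fun x => ⟨?_, ?_⟩⟩ fun x y => ?_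
  · intros; simp
  · intros; simp
  · intros; simp
  · intros; simp
  have h1 := hV.curvaturePart_skew x (J y) j (J k)
  linarith

/-- The terms of the second order identity that do not involve the Lee form or the Chern–Ricci
curvature. -/
theorem trace_ricciPart (hV : IsChernVariation J V) (htr : IsHermitianTrace J tr) (j k : E) :
    tr (fun x y => 1 / 2 * (metricPart V x j k y + metricPart V x k j y - metricPart V x y j k
        - (metricPart V j x k y + metricPart V j k x y - metricPart V j y x k))
      - 1 / 4 * nijenhuisPart J V x k y j
      + 1 / 2 * (psiPart J V x j k (J y) + psiPart J V x j (J k) y)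
      - (curvaturePart V x j k y - 1 / 2 * torsionPart V x k y j
        - 1 / 2 * torsionPart V x j (J k) (J y) - 1 / 2 * torsionPart V x (J y) j (J k)
        - torsionPart V j k x y)) = 0 := by
  refine htr.eq_zero (B := fun _ _ => 0)
    (C := fun x y => 1 / 2 * torsionPart V j k x y - 1 / 2 * V j x y k)
    ⟨fun y => ⟨?_, ?_⟩, fun x => ⟨?_, ?_⟩⟩ fun x y => ?_
  · intros; simp
  · intros; simp
  · intros; simp
  · intros; simp
  have h1 := hV.torsion x k y j
  have h2 := hV.torsion x k (J y) (J j)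
  have h3 := hV.metric x j k y
  have h4 := hV.torsion x j k y
  have h5 := hV.torsion x j (J k) (J y)
  simp only [curvaturePart, torsionPart, metricPart, nijenhuisPart, complexPart, psiPart,
    kahlerPart, hV.sq, map_neg, LinearMap.neg_apply] at *
  linarith

/-- The parts of second order of the two sides of the theorem agree. -/
theorem secondOrder_identity (hV : IsChernVariation J V) (htr : IsHermitianTrace J tr) (j k : E) :
    (1 / 2) * tr (fun x y => metricPart V x j k y + metricPart V x k j y - metricPart V x y j k
        - (metricPart V j x k y + metricPart V j k x y - metricPart V j y x k))
      + (1 / 2) * tr (fun x y => curvaturePart V j (J k) x (J y))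
    = (1 / 4) * tr (fun x y => nijenhuisPart J V x k y j)
      - (1 / 2) * (-(1 / 2) * tr (fun x y => psiPart J V j (J y) x k))
      + (1 / 2) * (-(1 / 2) * tr (fun x y => psiPart J V (J k) (J y) x (J j)))
      - (1 / 2) * tr (fun x y => psiPart J V x j k (J y) + psiPart J V x j (J k) y) := by
  have h : ∀ F G : E → E → ℝ, tr F = 0 → (∀ x y, F x y = G x y) → tr G = 0 :=
    fun F G hF hFG => funext₂ hFG ▸ hF
  rw [← sub_eq_zero]
  simp only [← smul_eq_mul, ← map_smul, ← map_sub, ← map_add]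
  -- the contracted Bianchi identities carry the weights `1/2`, `1/4`, `1/4` with which their
  -- curvature terms cancel; the traced `ψ` enters once for each of the two Lee form terms
  have key := congrArg₂ (· + ·) (hV.trace_ricciPart htr j k) (congrArg₂ (· + ·)
      (congrArg ((1 / 2 : ℝ) • ·) (hV.trace_bianchi₃ htr j k)) (congrArg₂ (· + ·)
      (congrArg ((1 / 4 : ℝ) • ·) (hV.trace_bianchi₁ htr j k)) (congrArg₂ (· + ·)
      (congrArg ((1 / 4 : ℝ) • ·) (hV.trace_bianchi₂ htr j k)) (congrArg₂ (· + ·)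
      (congrArg ((-1 / 4 : ℝ) • ·) (hV.trace_curvaturePart_map htr j k)) (congrArg₂ (· + ·)
      (congrArg ((-1 / 4 : ℝ) • ·) (hV.trace_psiPart htr j k))
      (congrArg ((1 / 4 : ℝ) • ·) (hV.trace_psiPart htr (J k) (J j))))))))
  simp only [smul_zero, add_zero, ← map_smul, ← map_add] at key
  refine h _ _ key fun x y => ?_
  simp only [Pi.add_apply, Pi.sub_apply, Pi.smul_apply, smul_eq_mul]
  ring

end IsChernVariation

end LinearAlgebra

/-! ### From components to multilinear forms -/

section Components

/-- The vector with components `δ_{ab}`. -/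
abbrev stdVec (a : Fin n) : Fin n → ℝ := Pi.single a 1

theorem IsLinearMap.eq_sum_stdVec {f : (Fin n → ℝ) → ℝ} (hf : IsLinearMap ℝ f) (v : Fin n → ℝ) :
    f v = ∑ q, v q * f (stdVec q) := by
  have h := congrArg (hf.mk' f) (pi_eq_sum_univ' v)
  simpa [stdVec, Pi.single_apply, eq_comm, funext_iff, map_sum] using h

theorem IsLinearMap.eq_zero_of_stdVec {f : (Fin n → ℝ) → ℝ} (hf : IsLinearMap ℝ f)
    (h : ∀ a, f (stdVec a) = 0) (v : Fin n → ℝ) : f v = 0 := by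
  simp [IsLinearMap.eq_sum_stdVec hf v, h]

/-- The quadrilinear form with components `W`. -/
def tensor4 (W : Fin n → Fin n → Fin n → Fin n → ℝ) :
    (Fin n → ℝ) →ₗ[ℝ] (Fin n → ℝ) →ₗ[ℝ] (Fin n → ℝ) →ₗ[ℝ] (Fin n → ℝ) →ₗ[ℝ] ℝ :=
  Fintype.linearCombination ℝ fun a => Fintype.linearCombination ℝ fun b =>
    Fintype.linearCombination ℝ fun i => Fintype.linearCombination ℝ fun j => W a b i j

@[simp]
theorem tensor4_stdVec (W : Fin n → Fin n → Fin n → Fin n → ℝ) (a b i j : Fin n) :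
    tensor4 W (stdVec a) (stdVec b) (stdVec i) (stdVec j) = W a b i j := by
  simp [tensor4, Fintype.linearCombination_apply_single]

/-- The endomorphism `∂ᵢ ↦ ∑ⱼ J_i^j ∂ⱼ`. -/
abbrev endo (J : Matrix (Fin n) (Fin n) ℝ) : (Fin n → ℝ) →ₗ[ℝ] (Fin n → ℝ) :=
  J.vecMulLinear

theorem endo_stdVec (J : Matrix (Fin n) (Fin n) ℝ) (i : Fin n) : endo J (stdVec i) = J i := by
  simp [endo]
  rfl

/-- The contraction of two slots with the matrix `B`. -/
def contraction (B : Matrix (Fin n) (Fin n) ℝ) :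
    ((Fin n → ℝ) → (Fin n → ℝ) → ℝ) →ₗ[ℝ] ℝ where
  toFun F := ∑ l, ∑ m, B l m * F (stdVec l) (stdVec m)
  map_add' F F' := by simp [mul_add, Finset.sum_add_distrib]
  map_smul' c F := by
    simp only [Finset.mul_sum, Pi.smul_apply, smul_eq_mul, RingHom.id_apply]
    exact Finset.sum_congr rfl fun _ _ => Finset.sum_congr rfl fun _ _ => by ring

theorem contraction_apply (B : Matrix (Fin n) (Fin n) ℝ) (F : (Fin n → ℝ) → (Fin n → ℝ) → ℝ) :
    contraction B F = ∑ l, ∑ m, B l m * F (stdVec l) (stdVec m) := rfl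

/-- An inner product and an orthogonal complex structure, in components. -/
structure IsHermitianPair (G J : Matrix (Fin n) (Fin n) ℝ) : Prop where
  symm : G.transpose = G
  det : IsUnit G.det
  sq : J * J = -1
  compatible : J * G * J.transpose = G

namespace IsHermitianPair

variable {G J : Matrix (Fin n) (Fin n) ℝ}

theorem endo_endo (h : IsHermitianPair G J) (x : Fin n → ℝ) : endo J (endo J x) = -x := by
  simp [endo, h.sq, Matrix.vecMul_neg]

theorem mul_transpose (h : IsHermitianPair G J) : G * J.transpose = -(J * G) := by
  have := congrArg (J * ·) h.compatible
  simp only [← Matrix.mul_assoc, h.sq] at this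
  rw [← this]
  simp

/-- Moving `J` from an upper index to the lowered one changes the sign: `J` is skew. -/
theorem sum_mul_lowered (h : IsHermitianPair G J) (D : Matrix (Fin n) (Fin n) ℝ) (i k : Fin n) :
    ∑ p, J k p * (D * G) i p = -∑ l, (∑ p, D i p * J p l) * G l k := by
  have h1 : D * G * J.transpose = -(D * J * G) := by
    rw [Matrix.mul_assoc, h.mul_transpose, Matrix.mul_neg, Matrix.mul_assoc]
  have h2 := congrFun₂ h1 i k
  rw [Matrix.neg_apply, Matrix.mul_apply, Matrix.mul_apply (N := G)] at h2
  simp only [Matrix.mul_apply (N := J), Matrix.transpose_apply] at h2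
  rw [← h2]
  exact Finset.sum_congr rfl fun p _ => mul_comm _ _

theorem transpose_inv_mul (h : IsHermitianPair G J) : J.transpose * G⁻¹ * J = G⁻¹ := by
  have h1 : G * (J.transpose * G⁻¹ * J) = 1 := by
    calc G * (J.transpose * G⁻¹ * J) = G * J.transpose * G⁻¹ * J := by
          simp only [Matrix.mul_assoc]
      _ = -(J * (G * G⁻¹) * J) := by rw [h.mul_transpose]; simp only [Matrix.mul_assoc, neg_mul]
      _ = 1 := by rw [Matrix.mul_nonsing_inv _ h.det, Matrix.mul_one, h.sq, neg_neg]
  exact (Matrix.inv_eq_right_inv h1).symm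

/-- The inverse of the matrix `J G` of `ω`. -/
theorem kahler_inv (h : IsHermitianPair G J) : (J * G)⁻¹ = -(G⁻¹ * J) := by
  refine Matrix.inv_eq_right_inv ?_
  calc J * G * -(G⁻¹ * J) = -(J * (G * G⁻¹) * J) := by simp [Matrix.mul_assoc]
    _ = 1 := by rw [Matrix.mul_nonsing_inv _ h.det, Matrix.mul_one, h.sq, neg_neg]

theorem isHermitianTrace (h : IsHermitianPair G J) :
    IsHermitianTrace (endo J) (contraction G⁻¹) where
  symm F := by
    have hs : ∀ l m, G⁻¹ l m = G⁻¹ m l := fun l m => by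
      conv_lhs => rw [← h.symm, ← Matrix.transpose_nonsing_inv]
      rfl
    simp only [contraction_apply]
    rw [Finset.sum_comm]
    exact Finset.sum_congr rfl fun l _ => Finset.sum_congr rfl fun m _ => by rw [hs]
  invariant F hF := by
    simp only [contraction_apply, endo_stdVec]
    set X : Matrix (Fin n) (Fin n) ℝ := Matrix.of fun p q => F (stdVec p) (stdVec q) with hX
    have h1 : ∀ l m, F (J l) (J m) = (J * X * J.transpose) l m := by
      intro l m
      rw [IsLinearMap.eq_sum_stdVec (hF.left _)]
      simp only [IsLinearMap.eq_sum_stdVec (hF.right (stdVec _)) (J m), Matrix.mul_apply,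
        Matrix.transpose_apply, Finset.mul_sum, Finset.sum_mul, hX, Matrix.of_apply]
      rw [Finset.sum_comm]
      exact Finset.sum_congr rfl fun p _ => Finset.sum_congr rfl fun q _ => by ring
    have h2 : ∀ Y : Matrix (Fin n) (Fin n) ℝ,
        ∑ l, ∑ m, G⁻¹ l m * Y l m = (G⁻¹ * Y.transpose).trace := by
      intro Y
      simp [Matrix.trace, Matrix.mul_apply]
    have h3 : ∀ l m, F (stdVec l) (stdVec m) = X l m := fun _ _ => rfl
    simp only [h1, h3, h2]
    rw [Matrix.transpose_mul, Matrix.transpose_mul, Matrix.transpose_transpose,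
      ← Matrix.mul_assoc, ← Matrix.mul_assoc, Matrix.trace_mul_comm, ← Matrix.mul_assoc,
      ← Matrix.mul_assoc, h.transpose_inv_mul]

end IsHermitianPair

/-- A function linear in each of four arguments vanishes if its components do. -/
theorem tensor4_eq_zero {F : (Fin n → ℝ) → (Fin n → ℝ) → (Fin n → ℝ) → (Fin n → ℝ) → ℝ}
    (h₁ : ∀ y z w, IsLinearMap ℝ fun x => F x y z w)
    (h₂ : ∀ x z w, IsLinearMap ℝ fun y => F x y z w)
    (h₃ : ∀ x y w, IsLinearMap ℝ fun z => F x y z w)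
    (h₄ : ∀ x y z, IsLinearMap ℝ fun w => F x y z w)
    (h : ∀ a b i j, F (stdVec a) (stdVec b) (stdVec i) (stdVec j) = 0) (x y z w : Fin n → ℝ) :
    F x y z w = 0 :=
  IsLinearMap.eq_zero_of_stdVec (h₁ y z w) (fun a =>
    IsLinearMap.eq_zero_of_stdVec (h₂ _ z w) (fun b =>
      IsLinearMap.eq_zero_of_stdVec (h₃ _ _ w) (fun i =>
        IsLinearMap.eq_zero_of_stdVec (h₄ _ _ _) (fun j => h a b i j) w) z) y) x

/-- The constraints on the differences `V a b` of the matrices `∂_a Υ_b` for two Chern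
connections whose structures have the same `1`-jet `(G, J, …)`. -/
structure IsMatrixVariation (G J : Matrix (Fin n) (Fin n) ℝ)
    (V : Fin n → Fin n → Matrix (Fin n) (Fin n) ℝ) : Prop extends IsHermitianPair G J where
  metric : ∀ a b, V a b * G + (V a b * G).transpose = V b a * G + (V b a * G).transpose
  complex : ∀ a b, V a b * J - J * V a b = V b a * J - J * V b a
  torsion : ∀ a i j k, V a i j k - V a j i k
    + ∑ p, ∑ q, J i p * J j q * (V a p q k - V a q p k) = 0

/-- The form `V a b i j = ∂_a Υ_{bi}^s g_{sj}`. -/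
def lowered (G : Matrix (Fin n) (Fin n) ℝ) (V : Fin n → Fin n → Matrix (Fin n) (Fin n) ℝ) :
    (Fin n → ℝ) →ₗ[ℝ] (Fin n → ℝ) →ₗ[ℝ] (Fin n → ℝ) →ₗ[ℝ] (Fin n → ℝ) →ₗ[ℝ] ℝ :=
  tensor4 fun a b i j => (V a b * G) i j

@[simp]
theorem lowered_stdVec (G : Matrix (Fin n) (Fin n) ℝ)
    (V : Fin n → Fin n → Matrix (Fin n) (Fin n) ℝ) (a b i j : Fin n) :
    lowered G V (stdVec a) (stdVec b) (stdVec i) (stdVec j) = (V a b * G) i j :=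
  tensor4_stdVec _ a b i j

/-- Lowering an index of `∂_a ∂_b J = [∂_a Υ_b, J]`. -/
theorem IsHermitianPair.complexPart_stdVec {G J : Matrix (Fin n) (Fin n) ℝ}
    (h : IsHermitianPair G J) (V : Fin n → Fin n → Matrix (Fin n) (Fin n) ℝ) (a b i j : Fin n) :
    complexPart (endo J) (lowered G V) (stdVec a) (stdVec b) (stdVec i) (stdVec j)
      = ((V a b * J - J * V a b) * G) i j := by
  have h1 : (V a b * J - J * V a b) * G = -(V a b * G * J.transpose) - J * (V a b * G) := by
    rw [Matrix.mul_assoc (V a b) G, h.mul_transpose]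
    simp [Matrix.sub_mul, Matrix.mul_assoc]
  rw [h1]
  simp only [complexPart, endo_stdVec]
  rw [IsLinearMap.eq_sum_stdVec (f := fun v => lowered G V (stdVec a) (stdVec b) (stdVec i) v)
      ⟨by simp, by simp⟩ (J j),
    IsLinearMap.eq_sum_stdVec (f := fun v => lowered G V (stdVec a) (stdVec b) v (stdVec j))
      ⟨by simp, by simp⟩ (J i)]
  simp only [lowered_stdVec, Matrix.sub_apply, Matrix.neg_apply, Matrix.mul_apply (M := _ * G),
    Matrix.mul_apply (M := J), Matrix.transpose_apply]
  simp only [mul_comm]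

/-- The relation between the components of the torsion, with the last index lowered. -/
theorem torsionPart_add_eq_zero {G J : Matrix (Fin n) (Fin n) ℝ}
    {V : Fin n → Fin n → Matrix (Fin n) (Fin n) ℝ}
    (h : ∀ a i j k, V a i j k - V a j i k
      + ∑ p, ∑ q, J i p * J j q * (V a p q k - V a q p k) = 0) (x y z w : Fin n → ℝ) :
    torsionPart (lowered G V) x y z w
      + torsionPart (lowered G V) x (endo J y) (endo J z) w = 0 := by
    refine tensor4_eq_zero (F := fun x y z w => torsionPart (lowered G V) x y z w
      + torsionPart (lowered G V) x (endo J y) (endo J z) w) ?_ ?_ ?_ ?_ ?_ x y z w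
    · exact fun _ _ _ => ⟨by intros; simp [torsionPart]; ring, by intros; simp [torsionPart]; ring⟩
    · exact fun _ _ _ => ⟨by intros; simp [torsionPart]; ring, by intros; simp [torsionPart]; ring⟩
    · exact fun _ _ _ => ⟨by intros; simp [torsionPart]; ring, by intros; simp [torsionPart]; ring⟩
    · exact fun _ _ _ => ⟨by intros; simp [torsionPart]; ring, by intros; simp [torsionPart]; ring⟩
    · intro a i j k
      have h1 : torsionPart (lowered G V) (stdVec a) (J i) (J j) (stdVec k)
          = ∑ p, ∑ q, J i p * J j q * ((V a p * G) q k - (V a q * G) p k) := by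
        rw [IsLinearMap.eq_sum_stdVec
          (f := fun v => torsionPart (lowered G V) (stdVec a) v (J j) (stdVec k))
          ⟨by intros; simp [torsionPart]; ring, by intros; simp [torsionPart]; ring⟩ (J i)]
        refine Finset.sum_congr rfl fun p _ => ?_
        rw [IsLinearMap.eq_sum_stdVec
          (f := fun v => torsionPart (lowered G V) (stdVec a) (stdVec p) v (stdVec k))
          ⟨by intros; simp [torsionPart]; ring, by intros; simp [torsionPart]; ring⟩ (J j),
          Finset.mul_sum]
        refine Finset.sum_congr rfl fun q _ => ?_
        simp only [torsionPart, lowered_stdVec]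
        ring
      simp only [endo_stdVec]
      rw [h1]
      -- lower the index `k` of the relation between the components with one upper index
      have h2 : ∑ s, (V a i j s - V a j i s
          + ∑ p, ∑ q, J i p * J j q * (V a p q s - V a q p s)) * G s k = 0 := by
        simp [h]
      rw [← h2]
      simp only [torsionPart, lowered_stdVec, Matrix.mul_apply, add_mul, Finset.sum_add_distrib,
        Finset.sum_mul, ← Finset.sum_sub_distrib, ← sub_mul, Finset.mul_sum]
      congr 1
      rw [Finset.sum_comm_cycle]
      exact Finset.sum_congr rfl fun s _ => Finset.sum_congr rfl fun p _ =>
        Finset.sum_congr rfl fun q _ => by ring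

theorem IsMatrixVariation.isChernVariation {G J : Matrix (Fin n) (Fin n) ℝ}
    {V : Fin n → Fin n → Matrix (Fin n) (Fin n) ℝ} (h : IsMatrixVariation G J V) :
    IsChernVariation (endo J) (lowered G V) where
  sq := h.endo_endo
  metric x y z w := by
    rw [← sub_eq_zero]
    refine tensor4_eq_zero (F := fun x y z w => metricPart (lowered G V) x y z w
      - metricPart (lowered G V) y x z w) ?_ ?_ ?_ ?_ ?_ x y z w
    · exact fun _ _ _ => ⟨by intros; simp [metricPart]; ring, by intros; simp [metricPart]; ring⟩
    · exact fun _ _ _ => ⟨by intros; simp [metricPart]; ring, by intros; simp [metricPart]; ring⟩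
    · exact fun _ _ _ => ⟨by intros; simp [metricPart]; ring, by intros; simp [metricPart]; ring⟩
    · exact fun _ _ _ => ⟨by intros; simp [metricPart]; ring, by intros; simp [metricPart]; ring⟩
    · intro a b i j
      have := congrFun (congrFun (h.metric a b) i) j
      simp only [Matrix.add_apply, Matrix.transpose_apply] at this
      simpa only [metricPart, lowered_stdVec, sub_eq_zero] using this
  complex x y z w := by
    rw [← sub_eq_zero]
    refine tensor4_eq_zero (F := fun x y z w => complexPart (endo J) (lowered G V) x y z w
      - complexPart (endo J) (lowered G V) y x z w) ?_ ?_ ?_ ?_ ?_ x y z w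
    · exact fun _ _ _ => ⟨by intros; simp [complexPart]; ring, by intros; simp [complexPart]; ring⟩
    · exact fun _ _ _ => ⟨by intros; simp [complexPart]; ring, by intros; simp [complexPart]; ring⟩
    · exact fun _ _ _ => ⟨by intros; simp [complexPart]; ring, by intros; simp [complexPart]; ring⟩
    · exact fun _ _ _ => ⟨by intros; simp [complexPart]; ring, by intros; simp [complexPart]; ring⟩
    · intro a b i j
      rw [h.complexPart_stdVec, h.complexPart_stdVec, h.complex, sub_self]
  torsion := torsionPart_add_eq_zero h.torsion

end Components

/-! ### Pointed local almost Hermitian structures -/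

/-- The value at `y` of a matrix of functions. -/
abbrev valueMatrix (A : Fin n → Fin n → Field n) (y : Coord n) : Matrix (Fin n) (Fin n) ℝ :=
  Matrix.of fun i j => A i j y

/-- An almost Hermitian structure `(g, J)` with its Chern connection `Υ` on an open set of the
coordinate space, and a point `y` of that set. -/
structure PointedChart (n : ℕ) where
  U : Set (Coord n)
  g : Fin n → Fin n → Field n
  J : Fin n → Fin n → Field n
  Υ : Fin n → Fin n → Fin n → Field n
  y : Coord n
  isOpen : IsOpen U
  mem : y ∈ U
  contDiffOn_g : ∀ i j, ContDiffOn ℝ ∞ (g i j) U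
  contDiffOn_J : ∀ i j, ContDiffOn ℝ ∞ (J i j) U
  hermitian : ∀ z ∈ U, IsHermitianPair (valueMatrix g z) (valueMatrix J z)
  chern : IsChernConnection U g J Υ

namespace PointedChart

/-- The `1`-jet of the structure at its point. -/
noncomputable def jet (s : PointedChart n) : OneJet n := oneJet s.g s.J s.y

/-- The value at the point of the difference of the two expressions compared in the theorem. -/
noncomputable def defect (s : PointedChart n) (j k : Fin n) : ℝ :=
  ricciDifference s.g s.J s.Υ j k s.y - principalExpression s.g s.J s.Υ j k s.y

theorem mem_nhds (s : PointedChart n) : s.U ∈ 𝓝 s.y := s.isOpen.mem_nhds s.mem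

theorem contDiffAt_g (s : PointedChart n) {z : Coord n} (hz : z ∈ s.U) (i j : Fin n) :
    ContDiffAt ℝ ∞ (s.g i j) z := (s.contDiffOn_g i j).contDiffAt (s.isOpen.mem_nhds hz)

theorem contDiffAt_J (s : PointedChart n) {z : Coord n} (hz : z ∈ s.U) (i j : Fin n) :
    ContDiffAt ℝ ∞ (s.J i j) z := (s.contDiffOn_J i j).contDiffAt (s.isOpen.mem_nhds hz)

theorem contDiffAt_Υ (s : PointedChart n) (i j k : Fin n) :
    ContDiffAt ℝ ∞ (s.Υ i j k) s.y := (s.chern.smooth i j k).contDiffAt s.mem_nhds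

theorem g_symm (s : PointedChart n) {z : Coord n} (hz : z ∈ s.U) (i j : Fin n) :
    s.g i j z = s.g j i z := congrFun (congrFun (s.hermitian z hz).symm j) i

theorem pd_g (s : PointedChart n) {z : Coord n} (hz : z ∈ s.U) (a i j : Fin n) :
    pd a (s.g i j) z = ∑ m, (s.Υ a i m z * s.g m j z + s.Υ a j m z * s.g i m z) := by
  have := s.chern.metric z hz a i j
  simpa [nabla2, sub_eq_zero] using this

theorem pd_J (s : PointedChart n) {z : Coord n} (hz : z ∈ s.U) (a i j : Fin n) :
    pd a (s.J i j) z = ∑ m, s.Υ a i m z * s.J m j z - ∑ m, s.Υ a m j z * s.J i m z := by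
  have := s.chern.complex z hz a i j
  simp only [nablaEnd, Pi.add_apply, Pi.sub_apply, Finset.sum_apply, Pi.mul_apply] at this
  linarith

theorem torsion_eq (s : PointedChart n) {z : Coord n} (hz : z ∈ s.U) (i j k : Fin n) :
    s.Υ i j k z - s.Υ j i k z
      + ∑ a, ∑ b, s.J i a z * s.J j b z * (s.Υ a b k z - s.Υ b a k z) = 0 := by
  have := s.chern.torsion z hz i j k
  simp only [torsion, Pi.sub_apply] at this
  linarith

theorem kahlerForm_eq (s : PointedChart n) {z : Coord n} (hz : z ∈ s.U) :
    valueMatrix (kahlerForm s.g s.J) z = valueMatrix s.J z * valueMatrix s.g z := by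
  ext i j
  simp [kahlerForm, Matrix.mul_apply, s.g_symm hz j]

theorem invComp_kahlerForm (s : PointedChart n) {z : Coord n} (hz : z ∈ s.U) (i j : Fin n) :
    invComp (kahlerForm s.g s.J) i j z
      = -∑ m, (valueMatrix s.g z)⁻¹ i m * s.J m j z := by
  have h : invComp (kahlerForm s.g s.J) i j z = (valueMatrix (kahlerForm s.g s.J) z)⁻¹ i j := rfl
  rw [h, s.kahlerForm_eq hz, (s.hermitian z hz).kahler_inv]
  simp [Matrix.mul_apply]

variable {s t : PointedChart n}

/-- The components of the Chern connection at a point are determined by the `1`-jet of the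
structure there. -/
theorem Υ_eq_of_jet_eq (h : s.jet = t.jet) (b i k : Fin n) : s.Υ b i k s.y = t.Υ b i k t.y := by
  have hg : ∀ i j, s.g i j s.y = t.g i j t.y := fun i j => congrFun₂ (congrArg OneJet.g h) i j
  have hJ : ∀ i j, s.J i j s.y = t.J i j t.y := fun i j => congrFun₂ (congrArg OneJet.J h) i j
  have hdg : ∀ a i j, pd a (s.g i j) s.y = pd a (t.g i j) t.y :=
    fun a i j => congrFun₂ (congrFun (congrArg OneJet.dg h) a) i j
  have hdJ : ∀ a i j, pd a (s.J i j) s.y = pd a (t.J i j) t.y :=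
    fun a i j => congrFun₂ (congrFun (congrArg OneJet.dJ h) a) i j
  set G := valueMatrix s.g s.y with hG
  set J := valueMatrix s.J s.y with hJ'
  have hp : IsHermitianPair G J := s.hermitian _ s.mem
  set A : Fin n → Matrix (Fin n) (Fin n) ℝ :=
    fun b => Matrix.of fun i k => s.Υ b i k s.y - t.Υ b i k t.y with hA
  have hmetric : ∀ a, A a * G + (A a * G).transpose = 0 := by
    intro a
    ext i j
    have h1 := s.pd_g s.mem a i j
    have h2 := t.pd_g t.mem a i j
    rw [← hdg, h1, ← sub_eq_zero, ← Finset.sum_sub_distrib] at h2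
    simp only [Matrix.add_apply, Matrix.transpose_apply, Matrix.mul_apply, hA, hG, Matrix.of_apply,
      ← Finset.sum_add_distrib, Matrix.zero_apply]
    rw [← h2]
    refine Finset.sum_congr rfl fun m _ => ?_
    rw [← hg, ← hg, s.g_symm s.mem i m]
    ring
  have hcomplex : ∀ a, A a * J = J * A a := by
    intro a
    ext i j
    have h1 := s.pd_J s.mem a i j
    have h2 := t.pd_J t.mem a i j
    simp only [← hJ] at h2
    rw [← hdJ, h1] at h2
    simp only [Matrix.mul_apply, hA, hJ', Matrix.of_apply, sub_mul, mul_sub,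
      Finset.sum_sub_distrib]
    simp only [mul_comm (s.J i _ s.y)]
    linarith
  have htorsion : ∀ i j, ∀ k, A i j k - A j i k
      + ∑ p, ∑ q, J i p * J j q * (A p q k - A q p k) = 0 := by
    intro i j k
    have h1 := s.torsion_eq s.mem i j k
    have h2 := t.torsion_eq t.mem i j k
    simp only [← hJ] at h2
    rw [← sub_eq_zero.2 (h1.trans h2.symm), add_sub_add_comm, ← Finset.sum_sub_distrib]
    simp only [← Finset.sum_sub_distrib, hA, hJ', Matrix.of_apply]
    congr 1
    · ring
    · exact Finset.sum_congr rfl fun p _ => Finset.sum_congr rfl fun q _ => by ring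
  have hzero := connectionDifference_eq_zero hp.endo_endo (A := lowered G (fun _ => A) (stdVec b))
    (fun x y z => ?_) (fun x y z => ?_) (fun x y z => ?_)
  · have hAG : A b * G = 0 := by
      ext i j
      simpa using hzero (stdVec b) (stdVec i) (stdVec j)
    have hA0 : A b = 0 := by
      rw [← Matrix.mul_nonsing_inv_cancel_right G (A b) hp.det, hAG, Matrix.zero_mul]
    exact sub_eq_zero.1 (congrFun₂ hA0 i k)
  · refine tensor4_eq_zero (F := metricPart (lowered G fun _ => A)) ?_ ?_ ?_ ?_ ?_ _ x y z
    · exact fun _ _ _ => ⟨by intros; simp [metricPart]; ring, by intros; simp [metricPart]; ring⟩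
    · exact fun _ _ _ => ⟨by intros; simp [metricPart]; ring, by intros; simp [metricPart]; ring⟩
    · exact fun _ _ _ => ⟨by intros; simp [metricPart]; ring, by intros; simp [metricPart]; ring⟩
    · exact fun _ _ _ => ⟨by intros; simp [metricPart]; ring, by intros; simp [metricPart]; ring⟩
    · intro a b i j
      simp only [metricPart, lowered_stdVec]
      exact congrFun₂ (hmetric b) i j
  · have := tensor4_eq_zero (F := complexPart (endo J) (lowered G fun _ => A)) ?_ ?_ ?_ ?_ ?_
      (stdVec b) x y z
    · simp only [complexPart] at this
      linarith
    · exact fun _ _ _ => ⟨by intros; simp [complexPart]; ring, by intros; simp [complexPart]; ring⟩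
    · exact fun _ _ _ => ⟨by intros; simp [complexPart]; ring, by intros; simp [complexPart]; ring⟩
    · exact fun _ _ _ => ⟨by intros; simp [complexPart]; ring, by intros; simp [complexPart]; ring⟩
    · exact fun _ _ _ => ⟨by intros; simp [complexPart]; ring, by intros; simp [complexPart]; ring⟩
    · intro a b i j
      rw [hp.complexPart_stdVec, hcomplex, sub_self]
      simp
  · exact torsionPart_add_eq_zero (fun _ => htorsion) (stdVec b) x y z

/-- The differences of the derivatives of the connection matrices of two pointed structures;
`variation s t a b i k` is the difference of the values of `∂_a Υ_{bi}^k`. -/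
noncomputable def variation (s t : PointedChart n) (a b : Fin n) : Matrix (Fin n) (Fin n) ℝ :=
  Matrix.of fun i k => pd a (s.Υ b i k) s.y - pd a (t.Υ b i k) t.y

/-- The value of the metric at the point. -/
abbrev G (s : PointedChart n) : Matrix (Fin n) (Fin n) ℝ := valueMatrix s.g s.y

/-- The value of the almost complex structure at the point. -/
abbrev K (s : PointedChart n) : Matrix (Fin n) (Fin n) ℝ := valueMatrix s.J s.y

/-! ### The parts of second order of the tensors in the theorem -/

theorem agreeAt_g (h : s.jet = t.jet) (i j : Fin n) :
    AgreeAt s.y t.y (s.g i j) (t.g i j) (fun _ => 0) where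
  left := (s.contDiffAt_g s.mem i j).differentiableAt (by simp)
  right := (t.contDiffAt_g t.mem i j).differentiableAt (by simp)
  val := congrFun₂ (congrArg OneJet.g h) i j
  der a := sub_eq_zero.2 (congrFun₂ (congrFun (congrArg OneJet.dg h) a) i j)

theorem agreeAt_J (h : s.jet = t.jet) (i j : Fin n) :
    AgreeAt s.y t.y (s.J i j) (t.J i j) (fun _ => 0) where
  left := (s.contDiffAt_J s.mem i j).differentiableAt (by simp)
  right := (t.contDiffAt_J t.mem i j).differentiableAt (by simp)
  val := congrFun₂ (congrArg OneJet.J h) i j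
  der a := sub_eq_zero.2 (congrFun₂ (congrFun (congrArg OneJet.dJ h) a) i j)

theorem agreeAt_Υ (h : s.jet = t.jet) (i j k : Fin n) :
    AgreeAt s.y t.y (s.Υ i j k) (t.Υ i j k) (fun a => variation s t a i j k) where
  left := (s.contDiffAt_Υ i j k).differentiableAt (by simp)
  right := (t.contDiffAt_Υ i j k).differentiableAt (by simp)
  val := Υ_eq_of_jet_eq h i j k
  der _ := rfl

theorem agreeAt_kahlerForm (h : s.jet = t.jet) (i j : Fin n) :
    AgreeAt s.y t.y (kahlerForm s.g s.J i j) (kahlerForm t.g t.J i j) (fun _ => 0) :=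
  (AgreeAt.sum Finset.univ fun m _ =>
    (agreeAt_J h i m).mul_of_left (agreeAt_g h j m)).congr_der fun a => by simp

theorem eventually_det_g (s : PointedChart n) : ∀ᶠ z in 𝓝 s.y, (valueMatrix s.g z).det ≠ 0 := by
  filter_upwards [s.mem_nhds] with z hz
  exact (s.hermitian z hz).det.ne_zero

theorem eventually_det_kahlerForm (s : PointedChart n) :
    ∀ᶠ z in 𝓝 s.y, (valueMatrix (kahlerForm s.g s.J) z).det ≠ 0 := by
  filter_upwards [s.mem_nhds] with z hz
  have h := s.hermitian z hz
  rw [s.kahlerForm_eq hz, Matrix.det_mul]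
  refine mul_ne_zero (fun h0 => ?_) h.det.ne_zero
  have := congrArg Matrix.det h.compatible
  rw [Matrix.det_mul, Matrix.det_mul, h0, zero_mul, zero_mul] at this
  exact h.det.ne_zero this.symm

theorem agreeAt_inv_g (h : s.jet = t.jet) (i j : Fin n) :
    AgreeAt s.y t.y (invComp s.g i j) (invComp t.g i j) (fun _ => 0) :=
  AgreeAt.invComp (agreeAt_g h) s.eventually_det_g t.eventually_det_g i j

theorem agreeAt_inv_kahlerForm (h : s.jet = t.jet) (i j : Fin n) :
    AgreeAt s.y t.y (invComp (kahlerForm s.g s.J) i j) (invComp (kahlerForm t.g t.J) i j)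
      (fun _ => 0) :=
  AgreeAt.invComp (agreeAt_kahlerForm h) s.eventually_det_kahlerForm
    t.eventually_det_kahlerForm i j

/-- `∇g = 0` expresses `∂g` by `Υ`, so the second derivatives of `g` vary with `∂Υ`. -/
theorem agreeAt_pd_g (h : s.jet = t.jet) (b i j : Fin n) :
    AgreeAt s.y t.y (pd b (s.g i j)) (pd b (t.g i j))
      (fun a => (variation s t a b * s.G + (variation s t a b * s.G).transpose) i j) := by
  have key := AgreeAt.sum Finset.univ fun m _ =>
    ((agreeAt_Υ h b i m).mul_of_right (agreeAt_g h m j)).add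
      ((agreeAt_Υ h b j m).mul_of_right (agreeAt_g h i m))
  refine (key.congr ?_ ?_).congr_der fun a => ?_
  · filter_upwards [s.mem_nhds] with z hz
    simp [s.pd_g hz]
  · filter_upwards [t.mem_nhds] with z hz
    simp [t.pd_g hz]
  · simp only [Matrix.add_apply, Matrix.transpose_apply, Matrix.mul_apply, Matrix.of_apply,
      ← Finset.sum_add_distrib, s.g_symm s.mem i]

/-- `∇J = 0` expresses `∂J` by `Υ`, so the second derivatives of `J` vary with `∂Υ`. -/
theorem agreeAt_pd_J (h : s.jet = t.jet) (b i j : Fin n) :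
    AgreeAt s.y t.y (pd b (s.J i j)) (pd b (t.J i j))
      (fun a => (variation s t a b * s.K - s.K * variation s t a b) i j) := by
  have key := (AgreeAt.sum Finset.univ fun m _ =>
    (agreeAt_Υ h b i m).mul_of_right (agreeAt_J h m j)).sub (AgreeAt.sum Finset.univ fun m _ =>
      (agreeAt_Υ h b m j).mul_of_right (agreeAt_J h i m))
  refine (key.congr ?_ ?_).congr_der fun a => ?_
  · filter_upwards [s.mem_nhds] with z hz
    simp [s.pd_J hz]
  · filter_upwards [t.mem_nhds] with z hz
    simp [t.pd_J hz]
  · simp only [Matrix.sub_apply, Matrix.mul_apply, Matrix.of_apply, mul_comm (s.J i _ s.y)]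

/-- The symmetries of the variation: second derivatives commute, and the derivative of the equation
`τ^{1,1} = 0` is linear in it. -/
theorem isMatrixVariation (h : s.jet = t.jet) :
    IsMatrixVariation s.G s.K (variation s t) where
  toIsHermitianPair := s.hermitian _ s.mem
  metric a b := by
    ext i j
    rw [← (agreeAt_pd_g h b i j).der a, ← (agreeAt_pd_g h a i j).der b,
      pd_comm (s.contDiffAt_g s.mem i j) a b, pd_comm (t.contDiffAt_g t.mem i j) a b]
  complex a b := by
    ext i j
    rw [← (agreeAt_pd_J h b i j).der a, ← (agreeAt_pd_J h a i j).der b,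
      pd_comm (s.contDiffAt_J s.mem i j) a b, pd_comm (t.contDiffAt_J t.mem i j) a b]
  torsion a i j k := by
    have key := ((agreeAt_Υ h i j k).sub (agreeAt_Υ h j i k)).add
      (AgreeAt.sum Finset.univ fun p _ => AgreeAt.sum Finset.univ fun q _ =>
        (((agreeAt_J h i p).mul_of_left (agreeAt_J h j q)).congr_der
          (d₂ := fun _ => 0) (fun _ => by simp)).mul_of_left
          ((agreeAt_Υ h p q k).sub (agreeAt_Υ h q p k)))
    refine (key.congr (G := fun _ => 0) (G' := fun _ => 0) ?_ ?_).der_unique (AgreeAt.const 0) a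
    · filter_upwards [s.mem_nhds] with z hz
      simpa using (s.torsion_eq hz i j k).symm
    · filter_upwards [t.mem_nhds] with z hz
      simpa using (t.torsion_eq hz i j k).symm

/-- The variation with its last index lowered: the difference of the two values of
`∂_a Υ_{bi}^s g_{sj}`. -/
noncomputable abbrev form (s t : PointedChart n) := lowered s.G (variation s t)

theorem isChernVariation (h : s.jet = t.jet) :
    IsChernVariation (endo s.K) (form s t) := (isMatrixVariation h).isChernVariation

theorem agreeAt_pd_metric (h : s.jet = t.jet) (b i j : Fin n) :
    AgreeAt s.y t.y (pd b (s.g i j)) (pd b (t.g i j))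
      (fun a => metricPart (form s t) (stdVec a) (stdVec b) (stdVec i) (stdVec j)) :=
  (agreeAt_pd_g h b i j).congr_der fun a => by simp only [metricPart, lowered_stdVec]; rfl

theorem agreeAt_christoffel (h : s.jet = t.jet) (i j k : Fin n) :
    AgreeAt s.y t.y (christoffel s.g i j k) (christoffel t.g i j k)
      (fun a => 1 / 2 * ∑ l, s.G⁻¹ k l *
        (metricPart (form s t) (stdVec a) (stdVec i) (stdVec j) (stdVec l)
          + metricPart (form s t) (stdVec a) (stdVec j) (stdVec i) (stdVec l)
          - metricPart (form s t) (stdVec a) (stdVec l) (stdVec i) (stdVec j))) :=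
  AgreeAt.smul (1 / 2) (AgreeAt.sum Finset.univ fun l _ => (agreeAt_inv_g h k l).mul_of_left
    (((agreeAt_pd_metric h i j l).add (agreeAt_pd_metric h j i l)).sub (agreeAt_pd_metric h l i j)))

theorem agreeAt_pd_kahlerForm (h : s.jet = t.jet) (b i j : Fin n) :
    AgreeAt s.y t.y (pd b (kahlerForm s.g s.J i j)) (pd b (kahlerForm t.g t.J i j))
      (fun a => kahlerPart (endo s.K) (form s t) (stdVec a) (stdVec b) (stdVec i) (stdVec j)) := by
  have key := AgreeAt.sum Finset.univ fun m _ =>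
    ((agreeAt_pd_J h b i m).mul_of_right (agreeAt_g h j m)).add
      ((agreeAt_J h i m).mul_of_left (agreeAt_pd_metric h b j m))
  have hpd : ∀ (s : PointedChart n), pd b (kahlerForm s.g s.J i j) =ᶠ[𝓝 s.y]
      ∑ m, (pd b (s.J i m) * s.g j m + s.J i m * pd b (s.g j m)) := by
    intro s
    filter_upwards [s.mem_nhds] with z hz
    have hJ := fun m => (s.contDiffAt_J hz i m).differentiableAt (by simp)
    have hg := fun m => (s.contDiffAt_g hz j m).differentiableAt (by simp)
    rw [kahlerForm, pd_sum _ fun m _ => (hJ m).mul (hg m)]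
    simp [pd_mul (hJ _) (hg _)]
  refine (key.congr (hpd s) (hpd t)).congr_der fun a => ?_
  have h1 := (isMatrixVariation h).complexPart_stdVec (variation s t) a b i j
  have h2 : ∑ m, s.J i m s.y * metricPart (form s t) (stdVec a) (stdVec b) (stdVec j) (stdVec m)
      = metricPart (form s t) (stdVec a) (stdVec b) (stdVec j) (s.K i) :=
    (IsLinearMap.eq_sum_stdVec
      (f := fun v => metricPart (form s t) (stdVec a) (stdVec b) (stdVec j) v)
      ⟨by intros; simp [metricPart]; ring, by intros; simp [metricPart]; ring⟩ (s.K i)).symm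
  rw [Finset.sum_add_distrib, h2]
  simp only [Matrix.mul_apply (N := s.G), Matrix.of_apply] at h1
  simp only [s.g_symm s.mem j, ← h1]
  simp only [complexPart, kahlerPart, metricPart, endo_stdVec]
  ring

theorem agreeAt_psi (h : s.jet = t.jet) (i j k : Fin n) :
    AgreeAt s.y t.y (psi s.g s.J i j k) (psi t.g t.J i j k)
      (fun a => psiPart (endo s.K) (form s t) (stdVec a) (stdVec i) (stdVec j) (stdVec k)) :=
  ((agreeAt_pd_kahlerForm h i j k).add (agreeAt_pd_kahlerForm h j k i)).add
    (agreeAt_pd_kahlerForm h k i j)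

end PointedChart

/-! ### Comparison of the two sides -/

section

variable {E : Type*} [AddCommGroup E] [Module ℝ E] (J : E →ₗ[ℝ] E)
  (V : E →ₗ[ℝ] E →ₗ[ℝ] E →ₗ[ℝ] E →ₗ[ℝ] ℝ)

theorem isLinearMap_psiPart₁ (i j k : E) : IsLinearMap ℝ fun v => psiPart J V v i j k :=
  ⟨by intros; simp [psiPart, kahlerPart]; ring, by intros; simp [psiPart, kahlerPart]; ring⟩

theorem isLinearMap_psiPart₂ (a j k : E) : IsLinearMap ℝ fun v => psiPart J V a v j k :=
  ⟨by intros; simp [psiPart, kahlerPart]; ring, by intros; simp [psiPart, kahlerPart]; ring⟩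

theorem isLinearMap_psiPart₃ (a i k : E) : IsLinearMap ℝ fun v => psiPart J V a i v k :=
  ⟨by intros; simp [psiPart, kahlerPart]; ring, by intros; simp [psiPart, kahlerPart]; ring⟩

theorem isLinearMap_psiPart₄ (a i j : E) : IsLinearMap ℝ fun v => psiPart J V a i j v :=
  ⟨by intros; simp [psiPart, kahlerPart]; ring, by intros; simp [psiPart, kahlerPart]; ring⟩

theorem isLinearMap_trace {tr : (E → E → ℝ) →ₗ[ℝ] ℝ} {F : E → E → E → ℝ}
    (hF : ∀ x y, IsLinearMap ℝ fun v => F v x y) (c : ℝ) :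
    IsLinearMap ℝ fun v => c * tr (F v) where
  map_add v w := by
    rw [show F (v + w) = F v + F w from funext₂ fun x y => (hF x y).map_add v w, map_add, mul_add]
  map_smul r v := by
    rw [show F (r • v) = r • F v from funext₂ fun x y => (hF x y).map_smul r v, map_smul,
      smul_eq_mul, smul_eq_mul]
    ring

/-- The second order part of `∂_v ϑ_w`, for the contraction `tr`. -/
noncomputable def leePart (tr : (E → E → ℝ) →ₗ[ℝ] ℝ) (v w : E) : ℝ :=
  -(1 / 2) * tr (fun x y => psiPart J V v (J y) x w)

end

namespace PointedChart

variable {s t : PointedChart n}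

theorem agreeAt_leeForm (h : s.jet = t.jet) (k : Fin n) :
    AgreeAt s.y t.y (leeForm s.g s.J k) (leeForm t.g t.J k)
      (fun a => leePart (endo s.K) (form s t) (contraction s.G⁻¹) (stdVec a) (stdVec k)) := by
  have key := AgreeAt.smul (1 / 2) (AgreeAt.sum Finset.univ fun i _ =>
    AgreeAt.sum Finset.univ fun j _ =>
      (agreeAt_inv_kahlerForm h j i).mul_of_left (agreeAt_psi h i j k))
  refine key.congr_der fun a => ?_
  simp only [s.invComp_kahlerForm s.mem, leePart, contraction_apply, endo_stdVec]
  simp only [IsLinearMap.eq_sum_stdVec (isLinearMap_psiPart₂ (endo s.K) (form s t) _ _ _) (s.K _)]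
  simp only [Finset.mul_sum, Finset.sum_mul, ← Finset.sum_neg_distrib]
  rw [Finset.sum_comm]
  refine Finset.sum_congr rfl fun j _ => ?_
  rw [Finset.sum_comm]
  exact Finset.sum_congr rfl fun m _ => Finset.sum_congr rfl fun i _ => by
    simp only [Matrix.of_apply]; ring

theorem agreeAt_nijenhuisLow (h : s.jet = t.jet) (i j k : Fin n) :
    AgreeAt s.y t.y (nijenhuisLow s.g s.J i j k) (nijenhuisLow t.g t.J i j k)
      (fun a => nijenhuisPart (endo s.K) (form s t)
        (stdVec a) (stdVec i) (stdVec j) (stdVec k)) := by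
  have hJ := agreeAt_J h
  have hd := agreeAt_pd_J h
  have key := AgreeAt.sum Finset.univ fun l _ =>
    ((AgreeAt.smul 2 (AgreeAt.sum Finset.univ fun p _ =>
      ((((hJ i p).mul_of_left (hd p j l)).sub ((hJ j p).mul_of_left (hd p i l))).sub
        ((hJ p l).mul_of_left (hd i j p))).add ((hJ p l).mul_of_left (hd j i p))))).mul_of_right
          (agreeAt_g h l k)
  refine key.congr_der fun a => ?_
  set D : Fin n → Matrix (Fin n) (Fin n) ℝ :=
    fun b => variation s t a b * s.K - s.K * variation s t a b with hD
  have hc : ∀ b i j, complexPart (endo s.K) (form s t) (stdVec a) (stdVec b) (stdVec i) (stdVec j)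
      = (D b * s.G) i j := fun b i j =>
    (isMatrixVariation h).complexPart_stdVec (variation s t) a b i j
  have hlin₂ : ∀ v i, complexPart (endo s.K) (form s t) (stdVec a) v (stdVec i) (stdVec k)
      = ∑ l, (∑ p, v p * D p i l) * s.G l k := fun v i => by
    rw [IsLinearMap.eq_sum_stdVec
      (f := fun v => complexPart (endo s.K) (form s t) (stdVec a) v (stdVec i) (stdVec k))
      ⟨by intros; simp [complexPart]; ring, by intros; simp [complexPart]; ring⟩ v]
    simp only [hc, Matrix.mul_apply, Finset.mul_sum, Finset.sum_mul]
    rw [Finset.sum_comm]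
    simp only [mul_assoc]
  have hlin₄ : ∀ b i, complexPart (endo s.K) (form s t) (stdVec a) (stdVec b) (stdVec i)
      (endo s.K (stdVec k)) = -∑ l, (∑ p, D b i p * s.K p l) * s.G l k := fun b i => by
    rw [IsLinearMap.eq_sum_stdVec
      (f := fun v => complexPart (endo s.K) (form s t) (stdVec a) (stdVec b) (stdVec i) v)
      ⟨by intros; simp [complexPart]; ring, by intros; simp [complexPart]; ring⟩]
    simp only [hc, endo_stdVec]
    exact (isMatrixVariation h).sum_mul_lowered (D b) i k
  simp only [nijenhuisPart, hlin₄]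
  simp only [hlin₂, endo_stdVec, Finset.sum_sub_distrib, Finset.sum_add_distrib,
    sub_mul, add_mul, mul_sub, mul_add, mul_assoc (2 : ℝ), ← Finset.mul_sum]
  simp only [mul_comm (D _ _ _), Matrix.of_apply]
  ring

theorem agreeAt_psiTwist (h : s.jet = t.jet) (j k e : Fin n) :
    AgreeAt s.y t.y (psiTwist s.g s.J j k e) (psiTwist t.g t.J j k e)
      (fun a => psiPart (endo s.K) (form s t) (stdVec a) (stdVec j) (stdVec k)
          (endo s.K (stdVec e))
        + psiPart (endo s.K) (form s t) (stdVec a) (stdVec j) (endo s.K (stdVec k))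
          (stdVec e)) := by
  have key := (AgreeAt.sum Finset.univ fun r _ =>
    (agreeAt_J h e r).mul_of_left (agreeAt_psi h j k r)).add
      (AgreeAt.sum Finset.univ fun m _ => (agreeAt_J h k m).mul_of_left (agreeAt_psi h j m e))
  refine key.congr_der fun a => ?_
  simp only [endo_stdVec]
  rw [IsLinearMap.eq_sum_stdVec (isLinearMap_psiPart₃ (endo s.K) (form s t) _ _ _) (s.K k),
    IsLinearMap.eq_sum_stdVec (isLinearMap_psiPart₄ (endo s.K) (form s t) _ _ _) (s.K e)]
  rfl

theorem ricci_sub_ricci (h : s.jet = t.jet) (j k : Fin n) :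
    ricci s.g j k s.y - ricci t.g j k t.y
      = 1 / 2 * contraction s.G⁻¹ (fun x y =>
        metricPart (form s t) x (stdVec j) (stdVec k) y
          + metricPart (form s t) x (stdVec k) (stdVec j) y
          - metricPart (form s t) x y (stdVec j) (stdVec k)
        - (metricPart (form s t) (stdVec j) x (stdVec k) y
          + metricPart (form s t) (stdVec j) (stdVec k) x y
          - metricPart (form s t) (stdVec j) y x (stdVec k))) := by
  simp only [ricci, Finset.sum_apply, contraction_apply]
  rw [← Finset.sum_sub_distrib, Finset.mul_sum]
  refine Finset.sum_congr rfl fun i _ => ?_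
  rw [curvature_sub_curvature (agreeAt_christoffel h), ← mul_sub, ← Finset.sum_sub_distrib]
  simp only [← mul_sub]

theorem chernRicci_sub_chernRicci (h : s.jet = t.jet) (a b : Fin n) :
    chernRicci s.g s.J s.Υ a b s.y - chernRicci t.g t.J t.Υ a b t.y
      = -contraction s.G⁻¹ (fun x y =>
        curvaturePart (form s t) (stdVec a) (stdVec b) x (endo s.K y)) := by
  have hg := fun i j => (agreeAt_g h i j).val
  have hw := fun i j => (agreeAt_inv_kahlerForm h i j).val
  simp only [chernRicci, Finset.sum_apply, Pi.mul_apply, ← hg, ← hw, contraction_apply,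
    endo_stdVec]
  simp only [← Finset.sum_sub_distrib, ← mul_sub, ← sub_mul,
    curvature_sub_curvature (agreeAt_Υ h), s.invComp_kahlerForm s.mem]
  rw [← Finset.sum_neg_distrib]
  refine Finset.sum_congr rfl fun c _ => ?_
  have h1 : ∀ m, curvaturePart (form s t) (stdVec a) (stdVec b) (stdVec c) (s.K m)
      = ∑ d, s.K m d * ∑ l, (variation s t a b c l - variation s t b a c l) * s.G l d := by
    intro m
    rw [IsLinearMap.eq_sum_stdVec
      (f := fun v => curvaturePart (form s t) (stdVec a) (stdVec b) (stdVec c) v)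
      ⟨by intros; simp [curvaturePart]; ring, by intros; simp [curvaturePart]; ring⟩]
    simp only [curvaturePart, lowered_stdVec, Matrix.mul_apply, sub_mul, Finset.sum_sub_distrib]
  simp only [h1]
  simp only [neg_mul, Finset.sum_mul, Finset.sum_neg_distrib]
  rw [Finset.sum_comm]
  simp only [Finset.mul_sum, Matrix.of_apply, mul_assoc]

/-- The defect is a function of the `1`-jet: the second order parts of the two sides cancel. -/
theorem defect_eq_of_jet_eq (h : s.jet = t.jet) : s.defect = t.defect := by
  ext j k
  have hJ := fun i j => (agreeAt_J h i j).val
  have hi := fun i j => (agreeAt_inv_g h i j).val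
  have hΥ := Υ_eq_of_jet_eq h
  have htr := (isMatrixVariation h).isHermitianTrace
  have hL : ricciDifference s.g s.J s.Υ j k s.y - ricciDifference t.g t.J t.Υ j k t.y
      = 1 / 2 * contraction s.G⁻¹ (fun x y =>
        metricPart (form s t) x (stdVec j) (stdVec k) y
          + metricPart (form s t) x (stdVec k) (stdVec j) y
          - metricPart (form s t) x y (stdVec j) (stdVec k)
        - (metricPart (form s t) (stdVec j) x (stdVec k) y
          + metricPart (form s t) (stdVec j) (stdVec k) x y
          - metricPart (form s t) (stdVec j) y x (stdVec k)))
        + 1 / 2 * contraction s.G⁻¹ (fun x y => curvaturePart (form s t) (stdVec j)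
          (endo s.K (stdVec k)) x (endo s.K y)) := by
    have hlin : IsLinearMap ℝ fun v => (-1 : ℝ) * contraction s.G⁻¹ (fun x y =>
        curvaturePart (form s t) (stdVec j) v x (endo s.K y)) :=
      isLinearMap_trace (F := fun v x y => curvaturePart (form s t) (stdVec j) v x (endo s.K y))
        (fun x y => ⟨by intros; simp [curvaturePart]; ring,
          by intros; simp [curvaturePart]; ring⟩) _
    have h1 := IsLinearMap.eq_sum_stdVec hlin (s.K k)
    simp only [neg_one_mul, ← chernRicci_sub_chernRicci h] at h1
    rw [endo_stdVec, ← ricci_sub_ricci h]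
    simp only [ricciDifference, Pi.sub_apply, Pi.smul_apply, Finset.sum_apply, Pi.mul_apply,
      smul_eq_mul, ← hJ]
    simp only [mul_sub, Finset.sum_sub_distrib, Matrix.of_apply] at h1
    linarith
  have hN : divNijenhuis s.g s.J s.Υ j k s.y - divNijenhuis t.g t.J t.Υ j k t.y
      = contraction s.G⁻¹ (fun x y =>
        nijenhuisPart (endo s.K) (form s t) x (stdVec k) y (stdVec j)) := by
    -- the derivative index is the second one of the inverse metric
    rw [← htr.symm]
    simp only [divNijenhuis, Finset.sum_apply, Pi.mul_apply, ← hi, contraction_apply]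
    simp only [← Finset.sum_sub_distrib, ← mul_sub,
      nabla3_sub_nabla3 hΥ (agreeAt_nijenhuisLow h)]
    rfl
  have hP : divPsiTwist s.g s.J s.Υ j k s.y - divPsiTwist t.g t.J t.Υ j k t.y
      = contraction s.G⁻¹ (fun x y =>
        psiPart (endo s.K) (form s t) x (stdVec j) (stdVec k) (endo s.K y)
        + psiPart (endo s.K) (form s t) x (stdVec j) (endo s.K (stdVec k)) y) := by
    rw [← htr.symm]
    simp only [divPsiTwist, Finset.sum_apply, Pi.mul_apply, ← hi, contraction_apply]
    simp only [← Finset.sum_sub_distrib, ← mul_sub, nabla3_sub_nabla3 hΥ (agreeAt_psiTwist h)]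
    rfl
  have hR : principalExpression s.g s.J s.Υ j k s.y - principalExpression t.g t.J t.Υ j k t.y
      = 1 / 4 * contraction s.G⁻¹ (fun x y =>
          nijenhuisPart (endo s.K) (form s t) x (stdVec k) y (stdVec j))
        - 1 / 2 * leePart (endo s.K) (form s t) (contraction s.G⁻¹) (stdVec j) (stdVec k)
        + 1 / 2 * leePart (endo s.K) (form s t) (contraction s.G⁻¹)
          (endo s.K (stdVec k)) (endo s.K (stdVec j))
        - 1 / 2 * contraction s.G⁻¹ (fun x y =>
          psiPart (endo s.K) (form s t) x (stdVec j) (stdVec k) (endo s.K y)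
          + psiPart (endo s.K) (form s t) x (stdVec j) (endo s.K (stdVec k)) y) := by
    have hlee : leePart (endo s.K) (form s t) (contraction s.G⁻¹)
          (endo s.K (stdVec k)) (endo s.K (stdVec j))
        = ∑ a, ∑ b, s.K k a * s.K j b *
          leePart (endo s.K) (form s t) (contraction s.G⁻¹) (stdVec a) (stdVec b) := by
      rw [endo_stdVec, endo_stdVec]
      refine (IsLinearMap.eq_sum_stdVec (isLinearMap_trace
        (fun x y => isLinearMap_psiPart₁ _ _ _ _ _) _) _).trans ?_
      refine Finset.sum_congr rfl fun a _ => ?_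
      refine (congrArg (s.K k a * ·) (IsLinearMap.eq_sum_stdVec (isLinearMap_trace
        (fun x y => isLinearMap_psiPart₄ _ _ _ _ _) _) _)).trans ?_
      simp only [Finset.mul_sum, mul_assoc]
      rfl
    rw [← hN, ← hP, hlee]
    simp only [← nabla1_sub_nabla1 hΥ (agreeAt_leeForm h), principalExpression, Pi.add_apply,
      Pi.sub_apply, Pi.smul_apply, Finset.sum_apply, Pi.mul_apply, smul_eq_mul, ← hJ, mul_sub,
      Finset.sum_sub_distrib, Matrix.of_apply]
    ring
  have key := (isChernVariation h).secondOrder_identity htr (stdVec j) (stdVec k)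
  simp only [leePart] at hR
  simp only [defect]
  linarith

end PointedChart

/-! ### Components of an almost Hermitian structure in a chart -/

section Manifold

variable {M : Type*} [TopologicalSpace M] [ChartedSpace (Coord n) M]
  {e : OpenPartialHomeomorph M (Coord n)}

theorem mdifferentiable_of_mem_maximalAtlas (he : e ∈ IsManifold.maximalAtlas (𝓡 n) ∞ M) :
    e.MDifferentiable (𝓡 n) (𝓡 n) :=
  ⟨(contMDiffOn_of_mem_maximalAtlas he).mdifferentiableOn (by simp),
    (contMDiffOn_symm_of_mem_maximalAtlas he).mdifferentiableOn (by simp)⟩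

/-- The coordinates of a tangent vector at the point with coordinates `y`. -/
noncomputable def coordOf (e : OpenPartialHomeomorph M (Coord n)) (y : Coord n) :
    TangentSpace (𝓡 n) (e.symm y) →L[ℝ] Coord n :=
  mfderiv (𝓡 n) (𝓡 n) e (e.symm y)

theorem coordOf_coordVector (he : e ∈ IsManifold.maximalAtlas (𝓡 n) ∞ M) {y : Coord n}
    (hy : y ∈ e.target) (i : Fin n) :
    coordOf e y (coordVector e y i) = EuclideanSpace.single i (1 : ℝ) := by
  have h := (mdifferentiable_of_mem_maximalAtlas he).comp_symm_deriv hy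
  exact congrArg (fun L => L (EuclideanSpace.single i (1 : ℝ) : Coord n)) h

theorem eq_sum_coordVector (he : e ∈ IsManifold.maximalAtlas (𝓡 n) ∞ M) {y : Coord n}
    (hy : y ∈ e.target) (v : TangentSpace (𝓡 n) (e.symm y)) :
    v = ∑ i, coordOf e y v i • coordVector e y i := by
  have h := (mdifferentiable_of_mem_maximalAtlas he).symm_comp_deriv (e.map_target hy)
  have h1 : mfderiv (𝓡 n) (𝓡 n) e.symm (e (e.symm y)) (coordOf e y v) = v :=
    congrArg (fun L => L v) h
  -- replaces the base point `e (e.symm y)` by `y`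
  have h2 : ∀ z : Coord n, z = y → ∀ w : Coord n,
      (mfderiv (𝓡 n) (𝓡 n) e.symm z : Coord n →L[ℝ] Coord n) w
        = (mfderiv (𝓡 n) (𝓡 n) e.symm y : Coord n →L[ℝ] Coord n) w := by
    rintro z rfl w
    rfl
  have h3 : coordOf e y v = ∑ i, coordOf e y v i • EuclideanSpace.single i (1 : ℝ) := by
    ext j
    simp [Pi.single_apply]
  have h4 : ∀ (L : Coord n →L[ℝ] Coord n) (w : Coord n),
      w = ∑ i, w i • EuclideanSpace.single i (1 : ℝ) →
      L w = ∑ i, w i • L (EuclideanSpace.single i (1 : ℝ)) := by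
    intro L w hw
    conv_lhs => rw [hw]
    simp only [map_sum, map_smul]
  exact (h1.symm.trans (h2 _ (e.right_inv hy) _)).trans (h4 _ _ h3)

variable [IsManifold (𝓡 n) ∞ M]

/-- The coordinate fields are smooth sections: they are images of constant fields under the tangent
map of `e.symm`. -/
theorem contMDiffOn_coordVector (he : e ∈ IsManifold.maximalAtlas (𝓡 n) ∞ M) (i : Fin n) :
    ContMDiffOn (𝓡 n) (𝓡 n).tangent ∞
      (fun y => (⟨e.symm y, coordVector e y i⟩ : TangentBundle (𝓡 n) M)) e.target := by
  have : IsManifold (𝓡 n) 1 M := IsManifold.of_le (n := ∞) (by simp)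
  have h1 := (contMDiffOn_symm_of_mem_maximalAtlas he).contMDiffOn_tangentMapWithin
    (m := ∞) (by simp) e.open_target.uniqueMDiffOn
  have h2 : ContMDiffOn (𝓡 n) (𝓡 n).tangent ∞
      (fun y => (⟨y, EuclideanSpace.single i (1 : ℝ)⟩ : TangentBundle (𝓡 n) (Coord n)))
      e.target :=
    contMDiffOn_vectorSpace_iff_contDiffOn.2 contDiffOn_const
  refine (h1.comp h2 fun y hy => hy).congr fun y hy => ?_
  simp only [Function.comp, tangentMapWithin, coordVector,
    mfderivWithin_of_isOpen e.open_target hy]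

theorem contDiffOn_metricComp (S : Structure n M) (he : e ∈ IsManifold.maximalAtlas (𝓡 n) ∞ M)
    (i j : Fin n) : ContDiffOn ℝ ∞ (S.metricComp e i j) e.target := by
  have h1 : ContMDiffOn (𝓡 n) ((𝓡 n).prod 𝓘(ℝ, Coord n →L[ℝ] Coord n →L[ℝ] ℝ)) ∞
      (fun y => Bundle.TotalSpace.mk' (Coord n →L[ℝ] Coord n →L[ℝ] ℝ)
        (E := fun x : M => TangentSpace (𝓡 n) x →L[ℝ] TangentSpace (𝓡 n) x →L[ℝ] ℝ)
        (e.symm y) (S.g.inner (e.symm y))) e.target :=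
    S.g.contMDiff.comp_contMDiffOn (contMDiffOn_symm_of_mem_maximalAtlas he)
  have h2 := ContMDiffOn.clm_bundle_apply₂ (F₃ := ℝ) (E₃ := Bundle.Trivial M ℝ) h1
    (contMDiffOn_coordVector he i) (contMDiffOn_coordVector he j)
  rw [← contMDiffOn_iff_contDiffOn]
  intro y hy
  have h3 := h2 y hy
  simp only [Bundle.contMDiffWithinAt_totalSpace] at h3
  exact h3.2

theorem contDiffOn_complexComp (S : Structure n M) (he : e ∈ IsManifold.maximalAtlas (𝓡 n) ∞ M)
    (i j : Fin n) : ContDiffOn ℝ ∞ (S.complexComp e i j) e.target := by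
  have : IsManifold (𝓡 n) 1 M := IsManifold.of_le (n := ∞) (by simp)
  have h1 : ContMDiffOn (𝓡 n) ((𝓡 n).prod 𝓘(ℝ, Coord n →L[ℝ] Coord n)) ∞
      (fun y => Bundle.TotalSpace.mk' (Coord n →L[ℝ] Coord n)
        (E := fun x : M => TangentSpace (𝓡 n) x →L[ℝ] TangentSpace (𝓡 n) x)
        (e.symm y) (S.J (e.symm y))) e.target :=
    S.contMDiff_J.comp_contMDiffOn (contMDiffOn_symm_of_mem_maximalAtlas he)
  have h2 := ContMDiffOn.clm_bundle_apply h1 (contMDiffOn_coordVector he i)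
  have h3 := (contMDiffOn_of_mem_maximalAtlas he).contMDiffOn_tangentMapWithin
    (m := ∞) (by simp) e.open_source.uniqueMDiffOn
  have h4 := (contMDiff_snd_tangentBundle_modelSpace (Coord n) (𝓡 n)).comp_contMDiffOn
    (h3.comp h2 fun y hy => e.map_target hy)
  rw [← contMDiffOn_iff_contDiffOn]
  have h5 : ContMDiff (𝓡 n) 𝓘(ℝ, ℝ) ∞ (fun v : Coord n => v j) :=
    (EuclideanSpace.proj (𝕜 := ℝ) j).contMDiff
  refine (h5.comp_contMDiffOn h4).congr fun y hy => ?_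
  simp only [Function.comp, tangentMapWithin, Structure.complexComp,
    mfderivWithin_of_isOpen e.open_source (e.map_target hy)]

theorem isHermitianPair_comp (S : Structure n M) (he : e ∈ IsManifold.maximalAtlas (𝓡 n) ∞ M)
    {y : Coord n} (hy : y ∈ e.target) :
    IsHermitianPair (valueMatrix (S.metricComp e) y) (valueMatrix (S.complexComp e) y) := by
  have hJ : ∀ i, S.J (e.symm y) (coordVector e y i)
      = ∑ j, S.complexComp e i j y • coordVector e y j := fun i =>
    eq_sum_coordVector he hy _
  have hcoord : ∀ i j, (coordOf e y (S.J (e.symm y) (coordVector e y i))).ofLp j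
      = S.complexComp e i j y := fun _ _ => rfl
  have hsq : valueMatrix (S.complexComp e) y * valueMatrix (S.complexComp e) y = -1 := by
    ext i k
    have h := congrArg (fun v => coordOf e y v k) (S.J_sq (e.symm y) (coordVector e y i))
    simp only [hJ i, map_sum, map_smul, map_neg, coordOf_coordVector he hy] at h
    simp only [Matrix.mul_apply, Matrix.of_apply, Matrix.neg_apply, Matrix.one_apply]
    simpa [hcoord, Pi.single_apply, eq_comm] using h
  refine ⟨?_, ?_, hsq, ?_⟩
  · ext i j
    exact S.g.symm _ _ _
  · rw [isUnit_iff_ne_zero, Ne, ← Matrix.exists_mulVec_eq_zero_iff]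
    rintro ⟨v, hv, hGv⟩
    have hw : ∑ i, v i • coordVector e y i = 0 := by
      by_contra hne
      refine (S.g.pos _ _ hne).ne' ?_
      have h : ∑ i, v i * ((valueMatrix (S.metricComp e) y).mulVec v) i = 0 := by simp [hGv]
      rw [← h]
      simp only [map_sum, map_smul, sum_apply, smul_apply,
        smul_eq_mul, Matrix.mulVec, dotProduct, Matrix.of_apply, Structure.metricComp]
      refine Finset.sum_congr rfl fun i _ => congrArg (v i * ·) ?_
      exact Finset.sum_congr rfl fun j _ => by rw [S.g.symm, mul_comm]
    refine hv (funext fun k => ?_)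
    have h := congrArg (fun w => coordOf e y w k) hw
    simpa [map_sum, map_smul, coordOf_coordVector he hy, Pi.single_apply] using h
  · ext i j
    have h := S.compatible (e.symm y) (coordVector e y i) (coordVector e y j)
    simp only [hJ, map_sum, map_smul, sum_apply,
      smul_apply, smul_eq_mul] at h
    simp only [Matrix.mul_apply, Matrix.of_apply, Matrix.transpose_apply]
    refine Eq.trans ?_ h
    refine Finset.sum_congr rfl fun b _ => (mul_comm _ _).trans (congrArg (_ * ·) ?_)
    exact Finset.sum_congr rfl fun a _ => rfl

end Manifold

end AlmostHermitian

theorem mainTheorem3 (n : ℕ) :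
    ∃ Q : AlmostHermitian.OneJet n → Fin n → Fin n → ℝ,
      ∀ (M : Type*) [TopologicalSpace M] [ChartedSpace (AlmostHermitian.Coord n) M]
        [IsManifold (𝓡 n) ∞ M] (S : AlmostHermitian.Structure n M)
        (e : OpenPartialHomeomorph M (AlmostHermitian.Coord n)),
        e ∈ IsManifold.maximalAtlas (𝓡 n) ∞ M →
        ∀ Υ : Fin n → Fin n → Fin n → AlmostHermitian.Field n,
          AlmostHermitian.IsChernConnection e.target (S.metricComp e) (S.complexComp e) Υ →
          ∀ y ∈ e.target, ∀ j k : Fin n,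
            AlmostHermitian.ricciDifference (S.metricComp e) (S.complexComp e) Υ j k y
              = AlmostHermitian.principalExpression (S.metricComp e) (S.complexComp e) Υ j k y
                + Q (AlmostHermitian.oneJet (S.metricComp e) (S.complexComp e) y) j k := by
  -- the defect, as a function of pointed charts, factors through the `1`-jet; off its image the
  -- value of `Q` is irrelevant
  have hfactors : Function.FactorsThrough (AlmostHermitian.PointedChart.defect (n := n))
      AlmostHermitian.PointedChart.jet :=
    fun _ _ h => AlmostHermitian.PointedChart.defect_eq_of_jet_eq h
  refine ⟨Function.extend AlmostHermitian.PointedChart.jet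
    AlmostHermitian.PointedChart.defect 0, ?_⟩
  intro M _ _ _ S e he Υ hΥ y hy j k
  have h := congrFun₂ (hfactors.extend_apply 0
    { U := e.target, g := S.metricComp e, J := S.complexComp e, Υ := Υ, y := y
      isOpen := e.open_target, mem := hy
      contDiffOn_g := AlmostHermitian.contDiffOn_metricComp S he
      contDiffOn_J := AlmostHermitian.contDiffOn_complexComp S he
      hermitian := fun _ hz => AlmostHermitian.isHermitianPair_comp S he hz
      chern := hΥ }) j k
  simp only [AlmostHermitian.PointedChart.jet, AlmostHermitian.PointedChart.defect] at h
  rw [h]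
  ring
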